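/- **Setting.** Let $\mathcal W,\mathcal Z$ be measurable spaces, $P_Z$ a probability distribution on $\mathcal Z$, and $N\ge 1$, $d,T\ge 0$ integers. Let $\theta\mapsto W_\theta$ be a measurable map $\mathbb R^d\to\mathcal W$ and let $\ell:\mathcal W\times\mathcal Z\to[a,b]$ be a bounded measurable loss such that $\theta\mapsto\ell(W_\theta,z)$ is differentiable for every $z$. For $A\subseteq[N]$ and $S=(Z_1,\dots,Z_N)$ write $L_{S_A}(w)=\frac1{|A|}\sum_{i\in A}\ell(w,Z_i)$, $L_S=L_{S_{[N]}}$, and $\mathrm{gen}(w,S)=\mathbb E_{Z\sim P_Z}[\ell(w,Z)]-L_S(w)$. Let $\tilde S=(\tilde Z_1,\dots,\tilde Z_{2N})$ be i.i.d. from $P_Z$, let $U=(U_1,\dots,U_N)$ be i.i.d. Bernoulli$(1/2)$, and let $S=(Z_1,\dots,Z_N)$ with $Z_i=\tilde Z_{i+U_iN}$. Stochastic gradient Langevin dynamics (SGLD) with step sizes $\eta_t\in\mathbb R$ and noise levels $\sigma_t>0$ starts from a random $\theta_0\in\mathbb R^d$ and iterates, for $t=1,\dots,T$, $$\theta_t=\theta_{t-1}-\eta_t\,\nabla_\theta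 L_{S_{V_t}}(W_\theta)\big|_{\theta=\theta_{t-1}}+\sigma_t\varepsilon_t ,$$ where the $\varepsilon_t\sim\mathcal N(0,I_d)$ are i.i.d. and $V^T=(V_1,\dots,V_T)$ are random batches $V_t\subseteq[N]$ (an empty batch contributes no gradient) with an arbitrary joint law. Put $W=W_{\theta_T}$. Let $J$ be uniform on $[N]$. The variables $\tilde S$, $U$, $J$, $V^T$, $\theta_0$ and $(\varepsilon_t)_{t\le T}$ are mutually independent. For $t\in[T]$, let $\pi_{J,t}\in[0,1]$ be any estimate of the probability that $U_J=1$, that is, any measurable function of $J$, $U_{J^c}=(U_i)_{i\ne J}$, $\tilde S$, $V^T$ and $\theta^{t-1}=(\theta_0,\dots,\theta_{t-1})$. Let $$\zeta_{J,t}=\nabla_\theta\ell(W_\theta,\tilde Z_J)\big|_{\theta=\theta_{t-1}}-\nabla_\theta\ell(W_\theta,\tilde Z_{J+N})\big|_{\theta=\theta_{t-1}}$$ and $\mathcal T_J(V^T)=\{t\in[T]: J\in V_t\}$. **Proposition 7.** Then $$\mathbb E[\mathrm{gen}(W,S)]\le\sqrt2\,(b-a)\;\mathbb E_{P_1}\left[\sqrt{\sum_{t\in\mathcal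 T_J(V^T)}\mathbb E_{P_2^t}\left[-\log\left(|U_J-\pi_{J,t}|\exp\left(-\frac{\eta_t^2\|\zeta_{J,t}\|^2}{2\sigma_t^2|V_t|^2}\right)+|1-\pi_{J,t}-U_J|\right)\right]}\;\right],$$ where $P_1$ is the joint law of $(J,\tilde S,U,V^T)$ and $P_2^t$ is the conditional law of $\theta^{t-1}$ given $(U,\tilde S,V_1,\dots,V_{t-1})$. The right-hand side may be $+\infty$ (and is $0$ if $a=b$). -/

import Mathlib

open MeasureTheory ProbabilityTheory
open scoped ENNReal Gradient

noncomputable section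

namespace SGLD

/-- The parameter space `ℝ^d` with its Euclidean norm. -/
abbrev Param (d : ℕ) : Type := EuclideanSpace ℝ (Fin d)

/-- A super-sample of `2N` points. The entry `s i false` is `Z̃_i` and `s i true` is `Z̃_{i+N}`,
so that `s i u` is `Z̃_{i + u N}`. -/
abbrev SuperSample (N : ℕ) (𝒵 : Type*) : Type _ := Fin N → Bool → 𝒵

/-- The dataset `S = (Z_1, …, Z_N)`, `Z_i = Z̃_{i + U_i N}`, selected from the super-sample. -/
def dataset {N : ℕ} {𝒵 : Type*} (s : SuperSample N 𝒵) (u : Fin N → Bool) : Fin N → 𝒵 :=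
  fun i => s i (u i)

/-- The value `0` or `1` of a bit as a real number. -/
def bit (u : Bool) : ℝ := if u then 1 else 0

/-- The empirical risk `L_{S_A}(w)` of the hypothesis `w` on the samples of `S` indexed by `A`
(zero if `A` is empty). -/
def empRisk {N : ℕ} {𝒲 𝒵 : Type*} (ℓ : 𝒲 → 𝒵 → ℝ) (S : Fin N → 𝒵) (A : Finset (Fin N))
    (w : 𝒲) : ℝ :=
  (∑ i ∈ A, ℓ w (S i)) / (A.card : ℝ)

/-- The population risk `L_{P_Z}(w)`. -/
def popRisk {𝒲 𝒵 : Type*} [MeasurableSpace 𝒵] (ℓ : 𝒲 → 𝒵 → ℝ) (PZ : Measure 𝒵) (w : 𝒲) : ℝ :=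
  ∫ z, ℓ w z ∂PZ

/-- The generalization error `gen(w, S) = L_{P_Z}(w) - L_S(w)`. -/
def gen {N : ℕ} {𝒲 𝒵 : Type*} [MeasurableSpace 𝒵] (ℓ : 𝒲 → 𝒵 → ℝ) (PZ : Measure 𝒵) (w : 𝒲)
    (S : Fin N → 𝒵) : ℝ :=
  popRisk ℓ PZ w - empRisk ℓ S Finset.univ w

/-- The two-sample incoherence at the parameter `θ`:
`∇_θ ℓ(W_θ, Z̃_j) - ∇_θ ℓ(W_θ, Z̃_{j+N})`. -/
def incoherence {N d : ℕ} {𝒲 𝒵 : Type*} (hyp : Param d → 𝒲) (ℓ : 𝒲 → 𝒵 → ℝ)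
    (s : SuperSample N 𝒵) (j : Fin N) (θ : Param d) : Param d :=
  ∇ (fun θ' => ℓ (hyp θ') (s j false)) θ - ∇ (fun θ' => ℓ (hyp θ') (s j true)) θ

/-- SGLD with `T` iterations in the randomized subsample setting, on a probability space `(Ω, P)`.
The index `t : Fin T` is that of the `(t+1)`-st iteration, which updates `θ t.castSucc` to
`θ t.succ` with step size `η t`, noise level `σ t`, batch `V t` and noise vector `ε t`.

* `St` is the super-sample, `U` the Bernoulli trials, `J` the random index;
* `V` is the batch trajectory (of arbitrary law), `ε` the noise;
* `θ` is the trajectory of parameters, with random initialization `θ 0` (of arbitrary law), and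
  `hyp (θ t ω)` is the hypothesis at that stage. -/
structure IsSGLD {Ω 𝒲 𝒵 : Type*} [MeasurableSpace Ω] [MeasurableSpace 𝒵] {N d T : ℕ}
    (P : Measure Ω) (PZ : Measure 𝒵) (hyp : Param d → 𝒲) (ℓ : 𝒲 → 𝒵 → ℝ) (η σ : Fin T → ℝ)
    (St : Ω → SuperSample N 𝒵) (U : Ω → Fin N → Bool) (J : Ω → Fin N)
    (V : Ω → Fin T → Finset (Fin N)) (ε : Ω → Fin T → Param d)
    (θ : Fin (T + 1) → Ω → Param d) : Prop where
  measurable_St : Measurable St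
  measurable_U : Measurable U
  measurable_J : Measurable J
  measurable_V : Measurable V
  measurable_ε : Measurable ε
  measurable_init : Measurable (θ 0)
  /-- The `2N` samples are i.i.d. with law `P_Z`. -/
  law_St : P.map St = Measure.pi fun _ => Measure.pi fun _ => PZ
  /-- The `U_i` are i.i.d. Bernoulli trials with parameter `1/2`. -/
  law_U : P.map U = Measure.pi fun _ => uniformOn Set.univ
  /-- The index `J` is uniformly distributed. -/
  law_J : P.map J = uniformOn Set.univ
  /-- The noise vectors are i.i.d. standard Gaussian. -/
  law_ε : P.map ε = Measure.pi fun _ => stdGaussian (Param d)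
  /-- Super-sample, Bernoulli trials, index, batch trajectory, initialization and noise are
  mutually independent. -/
  indep : P.map (fun ω => (St ω, U ω, J ω, V ω, θ 0 ω, ε ω)) =
    (P.map St).prod ((P.map U).prod ((P.map J).prod ((P.map V).prod
      ((P.map (θ 0)).prod (P.map ε)))))
  /-- The update rule of the algorithm, run on the dataset selected by `U`. -/
  update : ∀ (t : Fin T) (ω : Ω), θ t.succ ω = θ t.castSucc ω
    - η t • ∇ (fun θ' => empRisk ℓ (dataset (St ω) (U ω)) (V ω t) (hyp θ')) (θ t.castSucc ω)
    + σ t • ε ω t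

/-- The parameters `(θ_0, …, θ_t)` that precede the update with index `t`. -/
def pastParams {Ω : Type*} {d T : ℕ} (θ : Fin (T + 1) → Ω → Param d) (t : Fin T) (ω : Ω) :
    Fin (t + 1) → Param d :=
  fun k => θ (Fin.castLE (by omega) k) ω

/-- The batches that precede the batch with index `t`. -/
def pastBatches {N T : ℕ} (v : Fin T → Finset (Fin N)) (t : Fin T) : Fin t → Finset (Fin N) :=
  fun k => v (Fin.castLE (by omega) k)

/-- The conditional law of the past parameters given the Bernoulli trials, the super-sample and the
past batches. -/
def trajectoryLaw {Ω 𝒵 : Type*} [MeasurableSpace Ω] [MeasurableSpace 𝒵] {N d T : ℕ}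
    (P : Measure Ω) [IsFiniteMeasure P] (St : Ω → SuperSample N 𝒵) (U : Ω → Fin N → Bool)
    (V : Ω → Fin T → Finset (Fin N)) (θ : Fin (T + 1) → Ω → Param d) (t : Fin T) :
    Kernel ((Fin N → Bool) × SuperSample N 𝒵 × (Fin t → Finset (Fin N)))
      (Fin (t + 1) → Param d) :=
  condDistrib (pastParams θ t) (fun ω => (U ω, St ω, pastBatches (V ω) t)) P

/-- What an estimate of the probability of `U_j = 1` may use for the iteration with index `t`: the
bits `U_i`, `i ≠ j`, the super-sample, the batch trajectory and the past parameters. -/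
abbrev EstimateInput (N d T : ℕ) (𝒵 : Type*) (j : Fin N) (t : Fin T) : Type _ :=
  ({i : Fin N // i ≠ j} → Bool) × SuperSample N 𝒵 × (Fin T → Finset (Fin N)) ×
    (Fin (t + 1) → Param d)

/-- The summand `-log(|u - p| exp(-η² ‖ζ‖² / (2 σ² K²)) + |(1 - p) - u|)` for the bit `u`, the
estimate `p` and a batch of `K` samples. -/
def mixtureTerm {d : ℕ} (u p η σ : ℝ) (K : ℕ) (ζ : Param d) : ℝ :=
  -Real.log (|u - p| * Real.exp (-(η ^ 2 * ‖ζ‖ ^ 2 / (2 * σ ^ 2 * (K : ℝ) ^ 2))) + |(1 - p) - u|)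

end SGLD

end

noncomputable section

namespace SGLD

/-! ### Translates of the standard Gaussian measure -/

section GaussianShift

variable {E : Type*} [NormedAddCommGroup E] [InnerProductSpace ℝ E] [FiniteDimensional ℝ E]
  [MeasurableSpace E] [BorelSpace E]

/-! Fix an index `j`, the super-sample, the batches and all bits but that of `j`. The two values of
this bit give two runs of the algorithm whose datasets differ in one point, hence two laws `M`, `M'`
on paths with the same initial law and Gaussian steps of the same variance. Let `g` be the loss at
the final parameter on one point of the pair minus that on the other. The gap between unselected and
selected sample is `g` for one value of the bit and `-g` for the other, so the sum of the two
expected gaps is the difference of the integrals of `g` under `M` and `M'`.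

Both laws are compared with a common measure `Q`, which starts like them and at each step chooses
between the two Gaussian transitions with weights given by the estimate `π`. This is a single
measure because the estimate does not see the bit of `j`. One Gaussian against its mixture with a
translate costs at most `-log((1 - w) exp(-δ) + w)`, where `w` is its own weight and `δ` the
divergence from the other component (`integral_le_mixtureCost_add_log`). The chain rule adds these
costs along the path (`GibbsBound.extend`, `exists_common_gibbsBound`).

Relative entropy never appears: its role is played by the Gibbs variational inequality for bounded
functions. Applied to `r * g` and combined with Hoeffding's lemma under `Q`, it bounds the
difference of the integrals of `g` under `M` and `Q` by `√2 (b - a) √K`, with `K` the accumulated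
cost. Likewise for `-g` and `M'`; adding the two eliminates `Q` (`ofReal_integral_sub_integral_le`).
As flipping the bit preserves its law, averaging gives the bound for the expected gap of index `j`
(`ofReal_integral_ghostGap_le`).

The average of these gaps over `j` is the expected generalization error, since the output does not
depend on the unselected samples, which therefore act as fresh test points (`integral_gen_eq`).
Finally, the conditional law of the past parameters is the law of the recursion run with fresh noise
on the given data (`IsSGLD.trajectoryLaw_ae_eq`), which identifies the accumulated cost with the sum
in the theorem. -/

lemma integral_cexp_stdGaussian (h t : E) :
    ∫ x, Complex.exp ((inner ℝ h x : ℝ) + (inner ℝ x t : ℝ) * Complex.I) ∂(stdGaussian E) =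
      Complex.exp ((‖h‖ ^ 2 / 2 : ℝ) - (‖t‖ ^ 2 / 2 : ℝ) + (inner ℝ h t : ℝ) * Complex.I) := by
  set b := stdOrthonormalBasis ℝ E
  rw [stdGaussian, integral_map (Measurable.aemeasurable (by fun_prop))
    (Measurable.aestronglyMeasurable (by fun_prop))]
  have key : ∀ x : Fin (Module.finrank ℝ E) → ℝ,
      Complex.exp ((inner ℝ h (∑ i, x i • b i) : ℝ) + (inner ℝ (∑ i, x i • b i) t : ℝ) * Complex.I)
      = ∏ i, Complex.exp (((inner ℝ h (b i) : ℝ) + (inner ℝ (b i) t : ℝ) * Complex.I) *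
          (x i : ℝ)) := by
    intro x
    rw [← Complex.exp_sum]
    congr 1
    simp only [inner_sum, sum_inner, real_inner_smul_left, real_inner_smul_right,
      Complex.ofReal_sum, Complex.ofReal_mul, Finset.sum_mul, ← Finset.sum_add_distrib]
    exact Finset.sum_congr rfl fun i _ => by ring
  refine (integral_congr_ae (ae_of_all _ key)).trans ?_
  rw [integral_fintype_prod_eq_prod (f := fun i (x : ℝ) ↦
    Complex.exp (((inner ℝ h (b i) : ℝ) + (inner ℝ (b i) t : ℝ) * Complex.I) * (x : ℝ)))]
  have h1 : ∀ z : ℂ, ∫ x : ℝ, Complex.exp (z * x) ∂(gaussianReal 0 1) = Complex.exp (z ^ 2 / 2) := by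
    intro z
    have := complexMGF_id_gaussianReal (μ := 0) (v := 1) z
    simpa [complexMGF] using this
  simp_rw [h1]
  rw [← Complex.exp_sum]
  congr 1
  -- Parseval: the norms and the inner product become coordinate sums, to be matched with the sum of
  -- the squared complex coefficients.
  rw [← b.sum_sq_inner_right h, ← b.sum_sq_inner_right t, ← b.sum_inner_mul_inner h t]
  push_cast
  simp only [Finset.sum_div, Finset.sum_mul, ← Finset.sum_add_distrib, ← Finset.sum_sub_distrib]
  refine Finset.sum_congr rfl fun i _ => ?_
  rw [real_inner_comm (b i) h]
  ring_nf
  rw [Complex.I_sq]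
  ring

lemma integrable_exp_inner_stdGaussian (h : E) :
    Integrable (fun x => Real.exp (inner ℝ h x)) (stdGaussian E) := by
  have h1 := IsGaussian.map_eq_gaussianReal (μ := stdGaussian E) (innerSL ℝ h)
  have h2 := integrable_exp_mul_gaussianReal (μ := (stdGaussian E)[innerSL ℝ h])
    (v := (Var[innerSL ℝ h; stdGaussian E]).toNNReal) 1
  rw [← h1, integrable_map_measure (by fun_prop) (by fun_prop)] at h2
  simpa [Function.comp_def] using h2

lemma integral_exp_inner_stdGaussian (h : E) :
    ∫ x, Real.exp (inner ℝ h x) ∂(stdGaussian E) = Real.exp (‖h‖ ^ 2 / 2) := by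
  have := integral_cexp_stdGaussian h (0 : E)
  simp only [inner_zero_right, Complex.ofReal_zero, zero_mul, add_zero, norm_zero] at this
  have h2 : ∀ x : E, Complex.exp ((inner ℝ h x : ℝ) : ℂ) = ((Real.exp (inner ℝ h x) : ℝ) : ℂ) :=
    fun x => (Complex.ofReal_exp _).symm
  simp_rw [h2] at this
  rw [integral_complex_ofReal] at this
  have h3 : ((∫ x, Real.exp (inner ℝ h x) ∂(stdGaussian E) : ℝ) : ℂ) =
      ((Real.exp (‖h‖ ^ 2 / 2) : ℝ) : ℂ) := by
    rw [this]; push_cast; simp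
  exact_mod_cast h3

/-- Translating the standard Gaussian measure is an exponential change of density. -/
lemma stdGaussian_map_add_eq_tilted (h : E) :
    (stdGaussian E).map (· + h) = (stdGaussian E).tilted (fun x => inner ℝ h x) := by
  have : IsProbabilityMeasure ((stdGaussian E).tilted (fun x => inner ℝ h x)) :=
    isProbabilityMeasure_tilted (integrable_exp_inner_stdGaussian h)
  have : IsProbabilityMeasure ((stdGaussian E).map (· + h)) :=
    Measure.isProbabilityMeasure_map (by fun_prop)
  apply Measure.ext_of_charFun (E := E)
  ext t
  rw [charFun_apply, charFun_apply, integral_tilted, integral_exp_inner_stdGaussian,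
    integral_map (by fun_prop) (Measurable.aestronglyMeasurable (by fun_prop))]
  have h1 : ∀ x : E, (Real.exp (inner ℝ h x) / Real.exp (‖h‖ ^ 2 / 2)) •
      Complex.exp ((inner ℝ x t : ℝ) * Complex.I) = Complex.exp (-(‖h‖ ^ 2 / 2 : ℝ)) *
        Complex.exp ((inner ℝ h x : ℝ) + (inner ℝ x t : ℝ) * Complex.I) := by
    intro x
    rw [← Real.exp_sub, Complex.real_smul, Complex.ofReal_exp, ← Complex.exp_add,
      ← Complex.exp_add]
    congr 1
    push_cast
    ring
  have h2 : ∀ x : E, Complex.exp ((inner ℝ (x + h) t : ℝ) * Complex.I) =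
      Complex.exp ((inner ℝ h t : ℝ) * Complex.I) *
        Complex.exp ((inner ℝ (0 : E) x : ℝ) + (inner ℝ x t : ℝ) * Complex.I) := by
    intro x
    rw [← Complex.exp_add]
    congr 1
    rw [inner_add_left, inner_zero_left]
    push_cast
    ring
  -- Both characteristic functions are now instances of `integral_cexp_stdGaussian`, with real
  -- directions `h` and `0`.
  simp_rw [h1, h2]
  rw [integral_const_mul, integral_const_mul, integral_cexp_stdGaussian,
    integral_cexp_stdGaussian, ← Complex.exp_add, ← Complex.exp_add]
  congr 1
  simp
  ring

/-- A lower bound for the exponential moment of a bounded function under a translate of the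
standard Gaussian measure. -/
lemma exp_integral_sub_le_integral_exp_translate {F : E → ℝ} (hF : Measurable F) {C : ℝ}
    (hC : ∀ x, |F x| ≤ C) (h : E) :
    Real.exp (∫ x, F x ∂(stdGaussian E) - ‖h‖ ^ 2 / 2) ≤
      ∫ x, Real.exp (F (x + h)) ∂(stdGaussian E) := by
  have hFint : Integrable F (stdGaussian E) :=
    Integrable.of_bound hF.aestronglyMeasurable C (ae_of_all _ hC)
  have hinner : Integrable (fun x => inner ℝ h x) (stdGaussian E) :=
    (innerSL ℝ h).integrable_comp (IsGaussian.integrable_id (μ := stdGaussian E))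
  have hinner0 : ∫ x, inner ℝ h x ∂(stdGaussian E) = 0 :=
    integral_strongDual_stdGaussian (innerSL ℝ h)
  -- The change of density moves the translation out of `F` into a linear term of mean zero, so
  -- Jensen's inequality loses exactly `‖h‖ ^ 2 / 2`.
  have h1 : ∫ x, Real.exp (F (x + h)) ∂(stdGaussian E) =
      ∫ x, Real.exp (F x + inner ℝ h x - ‖h‖ ^ 2 / 2) ∂(stdGaussian E) := by
    rw [← integral_map (φ := (· + h)) (f := fun x => Real.exp (F x)) (by fun_prop)
      (Measurable.aestronglyMeasurable (by fun_prop)), stdGaussian_map_add_eq_tilted,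
      integral_tilted, integral_exp_inner_stdGaussian]
    refine integral_congr_ae (ae_of_all _ fun x => ?_)
    simp only [smul_eq_mul]
    rw [← Real.exp_sub, ← Real.exp_add]
    congr 1
    ring
  have hexp : Integrable (fun x => Real.exp (F x + inner ℝ h x - ‖h‖ ^ 2 / 2))
      (stdGaussian E) := by
    refine Integrable.mono' ((integrable_exp_inner_stdGaussian h).const_mul
      (Real.exp (C - ‖h‖ ^ 2 / 2))) (Measurable.aestronglyMeasurable (by fun_prop))
      (ae_of_all _ fun x => ?_)
    rw [Real.norm_eq_abs, Real.abs_exp, ← Real.exp_add]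
    apply Real.exp_le_exp.2
    have := (abs_le.1 (hC x)).2
    linarith
  have hint : Integrable (fun x => F x + inner ℝ h x - ‖h‖ ^ 2 / 2) (stdGaussian E) :=
    (hFint.add hinner).sub (integrable_const _)
  have h3 : ∫ x, (F x + inner ℝ h x - ‖h‖ ^ 2 / 2) ∂(stdGaussian E) =
      ∫ x, F x ∂(stdGaussian E) - ‖h‖ ^ 2 / 2 := by
    rw [integral_sub (f := fun x => F x + inner ℝ h x) (hFint.add hinner) (integrable_const _),
      integral_add hFint hinner, hinner0]
    simp
  rw [h1, ← h3]
  exact convexOn_exp.map_integral_le Real.continuous_exp.continuousOn isClosed_univ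
    (ae_of_all _ fun _ => Set.mem_univ _) hint hexp

end GaussianShift

/-! ### Optimization of exponential bounds and the cost of a mixture -/

/-- If all the affine-quadratic bounds hold then so does their optimum. -/
lemma le_sqrt_of_forall_mul_le {x K B : ℝ} (hK : 0 ≤ K) (hB : 0 ≤ B)
    (h : ∀ r : ℝ, 0 < r → r * x ≤ K + r ^ 2 * B ^ 2 / 2) : x ≤ √2 * B * √K := by
  rcases le_or_gt x 0 with hx | hx
  · exact hx.trans (by positivity)
  rcases hB.eq_or_lt with rfl | hB
  -- With `B = 0` the bound is linear in `r`; this choice makes the left side exceed `K` by one.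
  · have := h ((K + 1) / x) (by positivity)
    rw [div_mul_cancel₀ _ hx.ne'] at this
    norm_num at this
  -- The minimizer of `r ^ 2 * B ^ 2 / 2 - r * x`.
  · have h1 := h (x / B ^ 2) (by positivity)
    have h2 : x ^ 2 ≤ 2 * B ^ 2 * K := by
      have e1 : x / B ^ 2 * x = x ^ 2 / B ^ 2 := by ring
      have e2 : (x / B ^ 2) ^ 2 * B ^ 2 / 2 = x ^ 2 / B ^ 2 / 2 := by field_simp
      rw [e1, e2] at h1
      have h4 : x ^ 2 / B ^ 2 ≤ 2 * K := by linarith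
      rw [div_le_iff₀ (by positivity)] at h4
      linarith
    have h3 : √2 * B * √K = √(2 * B ^ 2 * K) := by
      rw [Real.sqrt_mul (by positivity), Real.sqrt_mul (by positivity), Real.sqrt_sq hB.le]
    rw [h3]
    exact Real.le_sqrt_of_sq_le h2

/-- Hoeffding's bound for the logarithmic exponential moment of a bounded function. -/
lemma log_integral_exp_le {α : Type*} [MeasurableSpace α] (Q : Measure α)
    [IsProbabilityMeasure Q] {g : α → ℝ} (hg : Measurable g) {B : ℝ} (hB : 0 ≤ B)
    (hgB : ∀ x, |g x| ≤ B) (r : ℝ) :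
    Real.log (∫ x, Real.exp (r * g x) ∂Q) ≤ r * ∫ x, g x ∂Q + r ^ 2 * B ^ 2 / 2 := by
  have h1 := (hasSubgaussianMGF_of_mem_Icc (μ := Q) (a := -B) (b := B) hg.aemeasurable
    (ae_of_all _ fun x => abs_le.1 (hgB x))).mgf_le r
  -- Hoeffding's variance proxy is the squared half-length of the interval `[-B, B]`.
  have h2 : (((‖B - -B‖₊ / 2) ^ 2 : NNReal) : ℝ) = B ^ 2 := by
    push_cast
    rw [Real.norm_eq_abs, abs_of_nonneg (by linarith)]
    ring
  rw [h2, mgf] at h1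
  have h3 : ∫ x, Real.exp (r * g x) ∂Q =
      Real.exp (r * ∫ x, g x ∂Q) * ∫ x, Real.exp (r * (g x - ∫ x, g x ∂Q)) ∂Q := by
    rw [← integral_const_mul]
    congr 1
    ext x
    rw [← Real.exp_add]
    congr 1
    ring
  have h4 : 0 < ∫ x, Real.exp (r * g x) ∂Q := by
    apply integral_exp_pos
    exact integrable_exp_mul_of_mem_Icc hg.aemeasurable (ae_of_all _ fun x => abs_le.1 (hgB x))
  rw [Real.log_le_iff_le_exp h4, h3, Real.exp_add]
  refine mul_le_mul_of_nonneg_left (h1.trans (Real.exp_le_exp.2 (by linarith))) (Real.exp_pos _).le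

/-- Upper bound for the divergence of the first component from a mixture of two components, when
the first component has weight `w` and has divergence `δ` from the second. -/
def mixtureCost (w δ : ℝ) : ℝ := -Real.log ((1 - w) * Real.exp (-δ) + w)

lemma mixtureCost_arg_pos {w : ℝ} (hw : w ∈ Set.Icc (0 : ℝ) 1) (δ : ℝ) :
    0 < (1 - w) * Real.exp (-δ) + w := by
  obtain ⟨h0, h1⟩ := hw
  have := Real.exp_pos (-δ)
  rcases h0.eq_or_lt with rfl | h0
  · simpa using this
  · have : 0 ≤ (1 - w) * Real.exp (-δ) := mul_nonneg (by linarith) this.le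
    linarith

lemma mixtureCost_nonneg {w δ : ℝ} (hw : w ∈ Set.Icc (0 : ℝ) 1) (hδ : 0 ≤ δ) :
    0 ≤ mixtureCost w δ := by
  have h1 : Real.exp (-δ) ≤ 1 := Real.exp_le_one_iff.2 (by linarith)
  have h2 : (1 - w) * Real.exp (-δ) ≤ (1 - w) * 1 :=
    mul_le_mul_of_nonneg_left h1 (by linarith [hw.2])
  exact neg_nonneg.2 (Real.log_nonpos (mixtureCost_arg_pos hw δ).le (by linarith))

lemma mixtureCost_zero (w : ℝ) : mixtureCost w 0 = 0 := by simp [mixtureCost]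

lemma measurable_snoc {α : Type*} [MeasurableSpace α] {t : ℕ} :
    Measurable fun p : (Fin t → α) × α =>
      (Fin.snoc (α := fun _ => α) p.1 p.2 : Fin (t + 1) → α) := by
  refine measurable_pi_iff.2 fun i => ?_
  refine Fin.lastCases ?_ (fun i => ?_) i
  · simpa using measurable_snd
  · simpa [Function.comp_def] using (measurable_pi_apply i).comp (measurable_fst (β := α))

/-! ### Paths with Gaussian steps and their mixture reference measure -/

section Path

variable {E : Type*} [NormedAddCommGroup E] [InnerProductSpace ℝ E] [FiniteDimensional ℝ E]
  [MeasurableSpace E] [BorelSpace E]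

/-- The Gibbs variational inequality for a Gaussian measure relative to a mixture of it with one
of its translates. -/
lemma integral_le_mixtureCost_add_log {f : E → ℝ} (hf : Measurable f) {C : ℝ}
    (hC : ∀ x, |f x| ≤ C) {w : ℝ} (hw : w ∈ Set.Icc (0 : ℝ) 1) (m m' : E) {c : ℝ} (hc : 0 < c) :
    ∫ x, f (m + c • x) ∂(stdGaussian E) ≤ mixtureCost w (‖m - m'‖ ^ 2 / (2 * c ^ 2)) +
      Real.log (w * ∫ x, Real.exp (f (m + c • x)) ∂(stdGaussian E) +
        (1 - w) * ∫ x, Real.exp (f (m' + c • x)) ∂(stdGaussian E)) := by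
  set a := ∫ x, f (m + c • x) ∂(stdGaussian E)
  have hg : Measurable fun x : E => f (m + c • x) := by fun_prop
  -- The same inequality serves both components: no shift for the one with mean `m`, and in units of
  -- `c` the shift that carries `m` to `m'` for the other. The weighted sum then has the common
  -- factor `exp a`.
  have h1 := exp_integral_sub_le_integral_exp_translate hg (fun x => hC _) (0 : E)
  have h2 := exp_integral_sub_le_integral_exp_translate hg (fun x => hC _) (c⁻¹ • (m' - m))
  have e1 : ∀ x : E, m + c • (x + c⁻¹ • (m' - m)) = m' + c • x := by
    intro x
    rw [smul_add, smul_inv_smul₀ hc.ne']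
    abel
  have e2 : ‖c⁻¹ • (m' - m)‖ ^ 2 / 2 = ‖m - m'‖ ^ 2 / (2 * c ^ 2) := by
    rw [norm_smul, norm_sub_rev, norm_inv, Real.norm_of_nonneg hc.le, mul_pow, inv_pow]
    field_simp
  simp only [e1, e2] at h2
  simp only [add_zero, norm_zero, ne_eq, OfNat.ofNat_ne_zero, not_false_eq_true, zero_pow,
    zero_div, sub_zero] at h1
  have h3 : Real.exp a * ((1 - w) * Real.exp (-(‖m - m'‖ ^ 2 / (2 * c ^ 2))) + w) ≤
      w * ∫ x, Real.exp (f (m + c • x)) ∂(stdGaussian E) +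
        (1 - w) * ∫ x, Real.exp (f (m' + c • x)) ∂(stdGaussian E) := by
    rw [sub_eq_add_neg, Real.exp_add] at h2
    have i1 := mul_le_mul_of_nonneg_left h1 hw.1
    have i2 := mul_le_mul_of_nonneg_left h2 (sub_nonneg.2 hw.2)
    calc _ = w * Real.exp a +
          (1 - w) * (Real.exp a * Real.exp (-(‖m - m'‖ ^ 2 / (2 * c ^ 2)))) := by ring
      _ ≤ _ := add_le_add i1 i2
  have h4 := mixtureCost_arg_pos hw (‖m - m'‖ ^ 2 / (2 * c ^ 2))
  have h5 := Real.log_le_log (mul_pos (Real.exp_pos a) h4) h3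
  rw [Real.log_mul (Real.exp_pos a).ne' h4.ne', Real.log_exp] at h5
  rw [mixtureCost]
  linarith

/-- The path `h` continued by the point `m h + c x`. -/
def extendPath {t : ℕ} (m : (Fin (t + 1) → E) → E) (c : ℝ) (p : (Fin (t + 1) → E) × E) :
    Fin (t + 1 + 1) → E :=
  Fin.snoc (α := fun _ => E) p.1 (m p.1 + c • p.2)

lemma measurable_extendPath {t : ℕ} {m : (Fin (t + 1) → E) → E} (hm : Measurable m) (c : ℝ) :
    Measurable (extendPath m c) := by
  unfold extendPath
  have h : Measurable fun p : (Fin (t + 1) → E) × E => (p.1, m p.1 + c • p.2) := by fun_prop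
  exact measurable_snoc.comp h

/-- There is a measure obtained by continuing a random path by a mixture of two Gaussian steps. -/
lemma exists_mixture_extension {t : ℕ} (Q : Measure (Fin (t + 1) → E)) [IsProbabilityMeasure Q]
    {m m' : (Fin (t + 1) → E) → E} (hm : Measurable m) (hm' : Measurable m') (c : ℝ)
    {w : (Fin (t + 1) → E) → ℝ} (hw : Measurable w) (hw1 : ∀ h, w h ∈ Set.Icc (0 : ℝ) 1) :
    ∃ Q' : Measure (Fin (t + 1 + 1) → E), IsProbabilityMeasure Q' ∧
      ∀ F : (Fin (t + 1 + 1) → E) → ℝ, Measurable F → ∀ C : ℝ, (∀ h, |F h| ≤ C) →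
        ∫ h, F h ∂Q' = ∫ h, (w h * ∫ x, F (extendPath m c (h, x)) ∂(stdGaussian E) +
          (1 - w h) * ∫ x, F (extendPath m' c (h, x)) ∂(stdGaussian E)) ∂Q := by
  have hφ := measurable_extendPath hm c
  have hφ' := measurable_extendPath hm' c
  have hd : Measurable fun h => ENNReal.ofReal (w h) := by fun_prop
  have hd' : Measurable fun h => ENNReal.ofReal (1 - w h) := by fun_prop
  have hfin : IsFiniteMeasure (Q.withDensity fun h => ENNReal.ofReal (w h)) := by
    refine isFiniteMeasure_withDensity_ofReal ?_
    exact (Integrable.of_bound hw.aestronglyMeasurable 1 (ae_of_all _ fun h => by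
      rw [Real.norm_eq_abs, abs_le]; constructor <;> linarith [(hw1 h).1, (hw1 h).2])).2
  have hfin' : IsFiniteMeasure (Q.withDensity fun h => ENNReal.ofReal (1 - w h)) := by
    refine isFiniteMeasure_withDensity_ofReal ?_
    exact (Integrable.of_bound (C := 1) (Measurable.aestronglyMeasurable (by fun_prop))
      (ae_of_all _ fun h => by
      rw [Real.norm_eq_abs, abs_le]; constructor <;> linarith [(hw1 h).1, (hw1 h).2])).2
  refine ⟨((Q.withDensity fun h => ENNReal.ofReal (w h)).prod (stdGaussian E)).map
      (extendPath m c) +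
    ((Q.withDensity fun h => ENNReal.ofReal (1 - w h)).prod (stdGaussian E)).map
      (extendPath m' c), ⟨?_⟩, ?_⟩
  · rw [Measure.add_apply, Measure.map_apply hφ .univ, Measure.map_apply hφ' .univ,
      Set.preimage_univ, Set.preimage_univ, ← Set.univ_prod_univ, Measure.prod_prod,
      Measure.prod_prod, measure_univ (μ := stdGaussian E), mul_one, mul_one, withDensity_apply _ .univ,
      withDensity_apply _ .univ, ← lintegral_add_left (by fun_prop)]
    have : ∀ h, ENNReal.ofReal (w h) + ENNReal.ofReal (1 - w h) = 1 := by
      intro h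
      rw [← ENNReal.ofReal_add (hw1 h).1 (by linarith [(hw1 h).2])]
      simp
    simp [this]
  · intro F hF C hC
    have hint : ∀ (ν : Measure ((Fin (t + 1) → E) × E)) [IsFiniteMeasure ν]
        (φ : (Fin (t + 1) → E) × E → (Fin (t + 1 + 1) → E)) (_ : Measurable φ),
        Integrable (fun p => F (φ p)) ν := fun ν _ φ hφ =>
      Integrable.of_bound (hF.comp hφ).aestronglyMeasurable C (ae_of_all _ fun p => hC _)
    have hbd : ∀ φ : (Fin (t + 1) → E) × E → (Fin (t + 1 + 1) → E), ∀ h,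
        |∫ x, F (φ (h, x)) ∂(stdGaussian E)| ≤ C := by
      intro φ h
      have := norm_integral_le_of_norm_le_const (μ := stdGaussian E)
        (ae_of_all _ fun x => (by exact hC _ : ‖F (φ (h, x))‖ ≤ C))
      simpa using this
    have hms : ∀ φ : (Fin (t + 1) → E) × E → (Fin (t + 1 + 1) → E), Measurable φ →
        Measurable fun h => ∫ x, F (φ (h, x)) ∂(stdGaussian E) := fun φ hφ =>
      ((hF.comp hφ).stronglyMeasurable.integral_prod_right' (ν := stdGaussian E)).measurable
    rw [integral_add_measure
      ((integrable_map_measure hF.aestronglyMeasurable hφ.aemeasurable).2 (hint _ _ hφ))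
      ((integrable_map_measure hF.aestronglyMeasurable hφ'.aemeasurable).2 (hint _ _ hφ')),
      integral_map hφ.aemeasurable hF.aestronglyMeasurable,
      integral_map hφ'.aemeasurable hF.aestronglyMeasurable,
      integral_prod _ (hint _ _ hφ), integral_prod _ (hint _ _ hφ'),
      integral_withDensity_eq_integral_toReal_smul hd (ae_of_all _ fun _ => ENNReal.ofReal_lt_top),
      integral_withDensity_eq_integral_toReal_smul hd' (ae_of_all _ fun _ => ENNReal.ofReal_lt_top),
      ← integral_add]
    · refine integral_congr_ae (ae_of_all _ fun h => ?_)
      simp only [smul_eq_mul]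
      rw [ENNReal.toReal_ofReal (hw1 h).1, ENNReal.toReal_ofReal (by linarith [(hw1 h).2])]
    · refine Integrable.of_bound (C := C) (Measurable.aestronglyMeasurable ?_) (ae_of_all _ ?_)
      · exact (by fun_prop : Measurable fun h => (ENNReal.ofReal (w h)).toReal).smul (hms _ hφ)
      · intro h
        rw [ENNReal.toReal_ofReal (hw1 h).1, norm_smul, Real.norm_eq_abs, Real.norm_eq_abs,
          abs_of_nonneg (hw1 h).1]
        calc _ ≤ 1 * C := mul_le_mul (hw1 h).2 (hbd _ h) (abs_nonneg _) zero_le_one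
          _ = C := one_mul _
    · refine Integrable.of_bound (C := C) (Measurable.aestronglyMeasurable ?_) (ae_of_all _ ?_)
      · exact (by fun_prop : Measurable fun h => (ENNReal.ofReal (1 - w h)).toReal).smul
          (hms _ hφ')
      · intro h
        rw [ENNReal.toReal_ofReal (by linarith [(hw1 h).2]), norm_smul, Real.norm_eq_abs,
          Real.norm_eq_abs, abs_of_nonneg (by linarith [(hw1 h).2])]
        calc _ ≤ 1 * C := mul_le_mul (by linarith [(hw1 h).1]) (hbd _ h) (abs_nonneg _) zero_le_one
          _ = C := one_mul _

/-- Every bounded function satisfies the Gibbs variational inequality with entropy at most `K` for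
the measure `M` relative to the measure `Q`. -/
def GibbsBound {α : Type*} [MeasurableSpace α] (M Q : Measure α) (K : ℝ) : Prop :=
  ∀ f : α → ℝ, Measurable f → ∀ C : ℝ, (∀ x, |f x| ≤ C) →
    ∫ x, f x ∂M ≤ K + Real.log (∫ x, Real.exp (f x) ∂Q)

/-- Jensen's inequality for the exponential. It starts the induction along the path, where both laws
still coincide with the reference measure. -/
lemma GibbsBound.refl {α : Type*} [MeasurableSpace α] (M : Measure α) [IsProbabilityMeasure M] :
    GibbsBound M M 0 := by
  intro f hf C hC
  have hfi : Integrable f M := Integrable.of_bound hf.aestronglyMeasurable C (ae_of_all _ hC)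
  have hei : Integrable (fun x => Real.exp (f x)) M :=
    Integrable.of_bound (C := Real.exp C) (Measurable.aestronglyMeasurable (by fun_prop))
      (ae_of_all _ fun x => by
        rw [Real.norm_eq_abs, Real.abs_exp]; exact Real.exp_le_exp.2 (abs_le.1 (hC x)).2)
  have := convexOn_exp.map_integral_le Real.continuous_exp.continuousOn isClosed_univ
    (ae_of_all M fun x => Set.mem_univ (f x)) hfi hei
  rw [zero_add, Real.le_log_iff_exp_le (integral_exp_pos hei)]
  exact this

/-- The chain rule: the Gibbs variational inequality is inherited by the continued paths. -/
lemma GibbsBound.extend {t : ℕ} {M Q : Measure (Fin (t + 1) → E)} [IsProbabilityMeasure M]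
    [IsProbabilityMeasure Q] {K : ℝ} (hMQ : GibbsBound M Q K)
    {m m' : (Fin (t + 1) → E) → E} (hm : Measurable m) (hm' : Measurable m') {c : ℝ} (hc : 0 < c)
    {w : (Fin (t + 1) → E) → ℝ} (hw : Measurable w) (hw1 : ∀ h, w h ∈ Set.Icc (0 : ℝ) 1)
    (hint : Integrable (fun h => mixtureCost (w h) (‖m h - m' h‖ ^ 2 / (2 * c ^ 2))) M)
    {Q' : Measure (Fin (t + 1 + 1) → E)}
    (hQ' : ∀ F : (Fin (t + 1 + 1) → E) → ℝ, Measurable F → ∀ C : ℝ, (∀ h, |F h| ≤ C) →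
        ∫ h, F h ∂Q' = ∫ h, (w h * ∫ x, F (extendPath m c (h, x)) ∂(stdGaussian E) +
          (1 - w h) * ∫ x, F (extendPath m' c (h, x)) ∂(stdGaussian E)) ∂Q) :
    GibbsBound ((M.prod (stdGaussian E)).map (extendPath m c)) Q'
      (K + ∫ h, mixtureCost (w h) (‖m h - m' h‖ ^ 2 / (2 * c ^ 2)) ∂M) := by
  intro f hf C hC
  have hφ := measurable_extendPath hm c
  have hφ' := measurable_extendPath hm' c
  -- `A` is the conditional exponential moment of `f` under the mixture step. The hypothesis on `M`
  -- and `Q` is applied to `log A`, whose exponential integrates under `Q` to the integral of `exp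
  -- f` under `Q'`.
  set A : (Fin (t + 1) → E) → ℝ := fun h =>
    w h * ∫ x, Real.exp (f (extendPath m c (h, x))) ∂(stdGaussian E) +
      (1 - w h) * ∫ x, Real.exp (f (extendPath m' c (h, x))) ∂(stdGaussian E) with hA
  have hms : ∀ (F : (Fin (t + 1 + 1) → E) → ℝ) (φ : (Fin (t + 1) → E) × E → (Fin (t + 1 + 1) → E)),
      Measurable F → Measurable φ → Measurable fun h => ∫ x, F (φ (h, x)) ∂(stdGaussian E) :=
    fun F φ hF hφ =>
    ((hF.comp hφ).stronglyMeasurable.integral_prod_right' (ν := stdGaussian E)).measurable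
  have hexpm : Measurable fun h => Real.exp (f h) := by fun_prop
  have hAm : Measurable A := by
    have h1 := hms _ _ hexpm hφ
    have h2 := hms _ _ hexpm hφ'
    exact (hw.mul h1).add ((measurable_const.sub hw).mul h2)
  have hbd : ∀ (φ : (Fin (t + 1) → E) × E → (Fin (t + 1 + 1) → E)), Measurable φ → ∀ h,
      ∫ x, Real.exp (f (φ (h, x))) ∂(stdGaussian E) ∈ Set.Icc (Real.exp (-C)) (Real.exp C) := by
    intro φ hφ h
    have hi : Integrable (fun x => Real.exp (f (φ (h, x)))) (stdGaussian E) := by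
      refine Integrable.of_bound (C := Real.exp C)
        (Measurable.aestronglyMeasurable (by fun_prop)) (ae_of_all _ fun x => ?_)
      rw [Real.norm_eq_abs, Real.abs_exp]; exact Real.exp_le_exp.2 (abs_le.1 (hC _)).2
    constructor
    · calc Real.exp (-C) = ∫ _, Real.exp (-C) ∂(stdGaussian E) := by simp
        _ ≤ _ := integral_mono (integrable_const _) hi fun x =>
          Real.exp_le_exp.2 (abs_le.1 (hC _)).1
    · calc _ ≤ ∫ _, Real.exp C ∂(stdGaussian E) := integral_mono hi (integrable_const _) fun x =>
          Real.exp_le_exp.2 (abs_le.1 (hC _)).2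
        _ = _ := by simp
  have hAbd : ∀ h, A h ∈ Set.Icc (Real.exp (-C)) (Real.exp C) := by
    intro h
    obtain ⟨a1, a2⟩ := hbd _ hφ h
    obtain ⟨b1, b2⟩ := hbd _ hφ' h
    obtain ⟨w0, w1⟩ := hw1 h
    constructor
    · have i1 := mul_le_mul_of_nonneg_left a1 w0
      have i2 := mul_le_mul_of_nonneg_left b1 (sub_nonneg.2 w1)
      simp only [hA]; linarith
    · have i1 := mul_le_mul_of_nonneg_left a2 w0
      have i2 := mul_le_mul_of_nonneg_left b2 (sub_nonneg.2 w1)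
      simp only [hA]; linarith
  have hApos : ∀ h, 0 < A h := fun h => (Real.exp_pos _).trans_le (hAbd h).1
  have hlogA : ∀ h, |Real.log (A h)| ≤ C := by
    intro h
    rw [abs_le]
    exact ⟨(Real.le_log_iff_exp_le (hApos h)).2 (hAbd h).1,
      (Real.log_le_iff_le_exp (hApos h)).2 (hAbd h).2⟩
  have hlogm : Measurable fun h => Real.log (A h) := hAm.log
  have h1 := hMQ _ hlogm C hlogA
  have h2 : ∫ h, Real.exp (Real.log (A h)) ∂Q = ∫ h, Real.exp (f h) ∂Q' := by
    rw [hQ' _ hexpm (Real.exp C) fun h => by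
      rw [Real.abs_exp]; exact Real.exp_le_exp.2 (abs_le.1 (hC _)).2]
    exact integral_congr_ae (ae_of_all _ fun h => Real.exp_log (hApos h))
  rw [h2] at h1
  have hfi : Integrable (fun p => f (extendPath m c p)) (M.prod (stdGaussian E)) :=
    Integrable.of_bound (hf.comp hφ).aestronglyMeasurable C (ae_of_all _ fun p => hC _)
  have hlogi : Integrable (fun h => Real.log (A h)) M :=
    Integrable.of_bound hlogm.aestronglyMeasurable C (ae_of_all _ hlogA)
  rw [integral_map hφ.aemeasurable hf.aestronglyMeasurable, integral_prod _ hfi]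
  have h3 : ∫ h, ∫ x, f (extendPath m c (h, x)) ∂(stdGaussian E) ∂M ≤
      ∫ h, (mixtureCost (w h) (‖m h - m' h‖ ^ 2 / (2 * c ^ 2)) + Real.log (A h)) ∂M := by
    refine integral_mono hfi.integral_prod_left (hint.add hlogi) fun h => ?_
    have hg : Measurable fun y : E => f (Fin.snoc (α := fun _ => E) h y) :=
      hf.comp (measurable_snoc.comp (measurable_const.prodMk measurable_id))
    exact integral_le_mixtureCost_add_log hg (fun x => hC _) (hw1 h) (m h) (m' h) hc
  rw [integral_add hint hlogi] at h3
  linarith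

/-- Two random paths with Gaussian steps, with the same initial law, satisfy Gibbs variational
inequalities relative to a common measure. -/
lemma exists_common_gibbsBound {T : ℕ} {M M' : (t : ℕ) → Measure (Fin (t + 1) → E)}
    (hMp : ∀ t, IsProbabilityMeasure (M t)) (hMp' : ∀ t, IsProbabilityMeasure (M' t))
    {m m' : (t : ℕ) → (Fin (t + 1) → E) → E} (hm : ∀ t, Measurable (m t))
    (hm' : ∀ t, Measurable (m' t)) {c : ℕ → ℝ} (hc : ∀ t < T, 0 < c t)
    {w : (t : ℕ) → (Fin (t + 1) → E) → ℝ} (hw : ∀ t, Measurable (w t))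
    (hw1 : ∀ t h, w t h ∈ Set.Icc (0 : ℝ) 1) (h0 : M 0 = M' 0)
    (hM : ∀ t < T, M (t + 1) = ((M t).prod (stdGaussian E)).map (extendPath (m t) (c t)))
    (hM' : ∀ t < T, M' (t + 1) = ((M' t).prod (stdGaussian E)).map (extendPath (m' t) (c t)))
    (hk : ∀ t < T, Integrable
      (fun h => mixtureCost (w t h) (‖m t h - m' t h‖ ^ 2 / (2 * c t ^ 2))) (M t))
    (hk' : ∀ t < T, Integrable
      (fun h => mixtureCost (1 - w t h) (‖m t h - m' t h‖ ^ 2 / (2 * c t ^ 2))) (M' t)) :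
    ∃ Q : Measure (Fin (T + 1) → E), IsProbabilityMeasure Q ∧
      GibbsBound (M T) Q (∑ t ∈ Finset.range T,
        ∫ h, mixtureCost (w t h) (‖m t h - m' t h‖ ^ 2 / (2 * c t ^ 2)) ∂(M t)) ∧
      GibbsBound (M' T) Q (∑ t ∈ Finset.range T,
        ∫ h, mixtureCost (1 - w t h) (‖m t h - m' t h‖ ^ 2 / (2 * c t ^ 2)) ∂(M' t)) := by
  induction T with
  | zero =>
    refine ⟨M 0, hMp 0, ?_, ?_⟩
    · have := hMp 0
      simpa using GibbsBound.refl (M 0)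
    · have := hMp' 0
      rw [h0]
      simpa using GibbsBound.refl (M' 0)
  | succ T ih =>
    obtain ⟨Q, hQ, hb, hb'⟩ := ih (fun t ht => hc t (by omega)) (fun t ht => hM t (by omega))
      (fun t ht => hM' t (by omega)) (fun t ht => hk t (by omega)) (fun t ht => hk' t (by omega))
    obtain ⟨Q', hQ'p, hQ'⟩ := exists_mixture_extension Q (hm T) (hm' T) (c T) (hw T) (hw1 T)
    have := hMp T
    have := hMp' T
    refine ⟨Q', hQ'p, ?_, ?_⟩
    · rw [hM T (by omega), Finset.sum_range_succ]
      exact hb.extend (hm T) (hm' T) (hc T (by omega)) (hw T) (hw1 T) (hk T (by omega)) hQ'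
    · rw [hM' T (by omega), Finset.sum_range_succ]
      have hk'T := hk' T (by omega)
      simp_rw [norm_sub_rev (m T _)] at hk'T ⊢
      -- The same mixture read from its other component: means exchanged, weight `1 - w`.
      refine hb'.extend (hm' T) (hm T) (hc T (by omega)) (w := fun h => 1 - w T h)
        (measurable_const.sub (hw T)) (fun h => ?_)
        hk'T ?_
      · exact ⟨by linarith [(hw1 T h).2], by linarith [(hw1 T h).1]⟩
      · intro F hF C hC
        rw [hQ' F hF C hC]
        refine integral_congr_ae (ae_of_all _ fun h => ?_)
        simp only
        ring

end Path

/-- The variational inequality for `r * g`, with Hoeffding's bound for its log-moment under `Q`,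
controls `r` times the difference by `K + r ^ 2 * B ^ 2 / 2`; then optimize over `r`. -/
lemma GibbsBound.integral_sub_le {α : Type*} [MeasurableSpace α] {M Q : Measure α}
    [IsProbabilityMeasure Q] {K : ℝ} (hK : 0 ≤ K)
    (h : GibbsBound M Q K) {g : α → ℝ} (hg : Measurable g) {B : ℝ} (hB : 0 ≤ B)
    (hgB : ∀ x, |g x| ≤ B) : ∫ x, g x ∂M - ∫ x, g x ∂Q ≤ √2 * B * √K := by
  refine le_sqrt_of_forall_mul_le hK hB fun r hr => ?_
  have h1 := h (fun x => r * g x) (by fun_prop) (r * B) fun x => by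
    rw [abs_mul, abs_of_pos hr]; exact mul_le_mul_of_nonneg_left (hgB x) hr.le
  rw [integral_const_mul] at h1
  have h2 := log_integral_exp_le Q hg hB hgB r
  rw [mul_sub]
  linarith

section Path

variable {E : Type*} [NormedAddCommGroup E] [InnerProductSpace ℝ E] [FiniteDimensional ℝ E]
  [MeasurableSpace E] [BorelSpace E]

lemma measurable_mixtureCost {α : Type*} [MeasurableSpace α] {w δ : α → ℝ} (hw : Measurable w)
    (hδ : Measurable δ) : Measurable fun x => mixtureCost (w x) (δ x) := by
  unfold mixtureCost
  fun_prop

/-- Two random paths with Gaussian steps and the same initial law cannot be told apart by a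
bounded function better than the costs of the mixtures of their steps allow. -/
lemma ofReal_integral_sub_integral_le {T : ℕ} {M M' : (t : ℕ) → Measure (Fin (t + 1) → E)}
    (hMp : ∀ t, IsProbabilityMeasure (M t)) (hMp' : ∀ t, IsProbabilityMeasure (M' t))
    {m m' : (t : ℕ) → (Fin (t + 1) → E) → E} (hm : ∀ t, Measurable (m t))
    (hm' : ∀ t, Measurable (m' t)) {c : ℕ → ℝ} (hc : ∀ t < T, 0 < c t)
    {w : (t : ℕ) → (Fin (t + 1) → E) → ℝ} (hw : ∀ t, Measurable (w t))
    (hw1 : ∀ t h, w t h ∈ Set.Icc (0 : ℝ) 1) (h0 : M 0 = M' 0)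
    (hM : ∀ t < T, M (t + 1) = ((M t).prod (stdGaussian E)).map (extendPath (m t) (c t)))
    (hM' : ∀ t < T, M' (t + 1) = ((M' t).prod (stdGaussian E)).map (extendPath (m' t) (c t)))
    {g : (Fin (T + 1) → E) → ℝ} (hg : Measurable g) {B : ℝ} (hgB : ∀ h, |g h| ≤ B) :
    ENNReal.ofReal (∫ h, g h ∂(M T) - ∫ h, g h ∂(M' T)) ≤ ENNReal.ofReal (√2 * B) *
      ((∑ t ∈ Finset.range T, ∫⁻ h, ENNReal.ofReal
          (mixtureCost (w t h) (‖m t h - m' t h‖ ^ 2 / (2 * c t ^ 2))) ∂(M t)) ^ (1 / 2 : ℝ) +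
        (∑ t ∈ Finset.range T, ∫⁻ h, ENNReal.ofReal
          (mixtureCost (1 - w t h) (‖m t h - m' t h‖ ^ 2 / (2 * c t ^ 2))) ∂(M' t))
            ^ (1 / 2 : ℝ)) := by
  have hB : 0 ≤ B := (abs_nonneg _).trans (hgB 0)
  -- The case `B = 0` is separate because there an infinite cost would be multiplied by zero. For `B
  -- > 0` an infinite cost makes the right side infinite.
  rcases hB.eq_or_lt with rfl | hBpos
  · have : g = 0 := by
      ext h
      exact abs_nonpos_iff.1 (hgB h)
    simp [this]
  set k : (t : ℕ) → (Fin (t + 1) → E) → ℝ := fun t h =>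
    mixtureCost (w t h) (‖m t h - m' t h‖ ^ 2 / (2 * c t ^ 2))
  set k' : (t : ℕ) → (Fin (t + 1) → E) → ℝ := fun t h =>
    mixtureCost (1 - w t h) (‖m t h - m' t h‖ ^ 2 / (2 * c t ^ 2))
  have hd : ∀ t, Measurable fun h => ‖m t h - m' t h‖ ^ 2 / (2 * c t ^ 2) := fun t =>
    (((hm t).sub (hm' t)).norm.pow_const 2).div_const _
  have hkm : ∀ t, Measurable (k t) := fun t => measurable_mixtureCost (hw t) (hd t)
  have hkm' : ∀ t, Measurable (k' t) := fun t =>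
    measurable_mixtureCost (measurable_const.sub (hw t)) (hd t)
  have hk0 : ∀ t h, 0 ≤ k t h := fun t h => mixtureCost_nonneg (hw1 t h) (by positivity)
  have hk0' : ∀ t h, 0 ≤ k' t h := fun t h => mixtureCost_nonneg
    ⟨by linarith [(hw1 t h).2], by linarith [(hw1 t h).1]⟩ (by positivity)
  have hBne : ENNReal.ofReal (√2 * B) ≠ 0 := by
    rw [Ne, ENNReal.ofReal_eq_zero, not_le]
    positivity
  by_cases hfin : ∑ t ∈ Finset.range T, ∫⁻ h, ENNReal.ofReal (k t h) ∂(M t) = ⊤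
  · rw [hfin, ENNReal.top_rpow_of_pos (by norm_num), top_add, ENNReal.mul_top hBne]
    exact le_top
  by_cases hfin' : ∑ t ∈ Finset.range T, ∫⁻ h, ENNReal.ofReal (k' t h) ∂(M' t) = ⊤
  · rw [hfin', ENNReal.top_rpow_of_pos (by norm_num), add_top, ENNReal.mul_top hBne]
    exact le_top
  have hki : ∀ t < T, Integrable (k t) (M t) := fun t ht =>
    ⟨(hkm t).aestronglyMeasurable, (hasFiniteIntegral_iff_ofReal (ae_of_all _ (hk0 t))).2
      (lt_top_iff_ne_top.2 fun h => hfin (ENNReal.sum_eq_top.2 ⟨t, Finset.mem_range.2 ht, h⟩))⟩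
  have hki' : ∀ t < T, Integrable (k' t) (M' t) := fun t ht =>
    ⟨(hkm' t).aestronglyMeasurable, (hasFiniteIntegral_iff_ofReal (ae_of_all _ (hk0' t))).2
      (lt_top_iff_ne_top.2 fun h => hfin' (ENNReal.sum_eq_top.2 ⟨t, Finset.mem_range.2 ht, h⟩))⟩
  obtain ⟨Q, hQ, hb, hb'⟩ := exists_common_gibbsBound hMp hMp' hm hm' hc hw hw1 h0 hM hM' hki hki'
  have hsum : ∑ t ∈ Finset.range T, ∫⁻ h, ENNReal.ofReal (k t h) ∂(M t) =
      ENNReal.ofReal (∑ t ∈ Finset.range T, ∫ h, k t h ∂(M t)) := by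
    rw [ENNReal.ofReal_sum_of_nonneg fun t _ => integral_nonneg (hk0 t)]
    exact Finset.sum_congr rfl fun t ht => (ofReal_integral_eq_lintegral_ofReal
      (hki t (Finset.mem_range.1 ht)) (ae_of_all _ (hk0 t))).symm
  have hsum' : ∑ t ∈ Finset.range T, ∫⁻ h, ENNReal.ofReal (k' t h) ∂(M' t) =
      ENNReal.ofReal (∑ t ∈ Finset.range T, ∫ h, k' t h ∂(M' t)) := by
    rw [ENNReal.ofReal_sum_of_nonneg fun t _ => integral_nonneg (hk0' t)]
    exact Finset.sum_congr rfl fun t ht => (ofReal_integral_eq_lintegral_ofReal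
      (hki' t (Finset.mem_range.1 ht)) (ae_of_all _ (hk0' t))).symm
  have hK : 0 ≤ ∑ t ∈ Finset.range T, ∫ h, k t h ∂(M t) :=
    Finset.sum_nonneg fun t _ => integral_nonneg (hk0 t)
  have hK' : 0 ≤ ∑ t ∈ Finset.range T, ∫ h, k' t h ∂(M' t) :=
    Finset.sum_nonneg fun t _ => integral_nonneg (hk0' t)
  have h1 := hb.integral_sub_le hK hg hB hgB
  -- With `-g` here, the integrals over `Q` cancel when the two bounds are added.
  have h2 := hb'.integral_sub_le hK' hg.neg hB fun h => by
    rw [Pi.neg_apply, abs_neg]; exact hgB h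
  simp only [Pi.neg_apply, integral_neg] at h2
  have hrpow : ∀ x : ℝ, 0 ≤ x → ENNReal.ofReal x ^ (1 / 2 : ℝ) = ENNReal.ofReal √x := by
    intro x hx
    rw [ENNReal.ofReal_rpow_of_nonneg hx (by norm_num), Real.sqrt_eq_rpow]
  rw [hsum, hsum', hrpow _ hK, hrpow _ hK', ← ENNReal.ofReal_add (by positivity) (by positivity),
    ← ENNReal.ofReal_mul (by positivity)]
  refine ENNReal.ofReal_le_ofReal ?_
  rw [mul_add]
  linarith

end Path

/-! ### Measurability of gradients and resampling of coordinates -/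

section Gradient

variable {E : Type*} [NormedAddCommGroup E] [InnerProductSpace ℝ E] [FiniteDimensional ℝ E]
  [MeasurableSpace E] [BorelSpace E]

/-- The gradient of a differentiable function that depends measurably on a parameter is jointly
measurable. -/
lemma measurable_gradient_of_param {α : Type*} [MeasurableSpace α] {f : α → E → ℝ}
    (hf : Measurable (Function.uncurry f)) (hd : ∀ a, Differentiable ℝ (f a)) :
    Measurable fun p : α × E => ∇ (f p.1) p.2 := by
  set b := stdOrthonormalBasis ℝ E
  have h1 : ∀ v : E, Measurable fun p : α × E => inner ℝ v (∇ (f p.1) p.2) := by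
    intro v
    -- A directional derivative is the pointwise limit of difference quotients with increments `v /
    -- n`.
    refine measurable_of_tendsto_metrizable (f := fun (n : ℕ) (p : α × E) =>
      (n : ℝ) • (f p.1 (p.2 + (n : ℝ)⁻¹ • v) - f p.1 p.2)) (fun n => ?_) ?_
    · have m1 : Measurable fun p : α × E => f p.1 (p.2 + (n : ℝ)⁻¹ • v) :=
        hf.comp (by fun_prop : Measurable fun p : α × E => (p.1, p.2 + (n : ℝ)⁻¹ • v))
      exact (m1.sub hf).const_mul (n : ℝ)
    · rw [tendsto_pi_nhds]
      intro p
      have h2 := ((hd p.1 p.2).hasGradientAt.hasFDerivAt.lim_real v).comp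
        tendsto_natCast_atTop_atTop
      rw [real_inner_comm]
      exact h2
  have h2 : (fun p : α × E => ∇ (f p.1) p.2) =
      fun p => ∑ i, inner ℝ (b i) (∇ (f p.1) p.2) • b i :=
    funext fun p => (b.sum_repr' _).symm
  rw [h2]
  exact Finset.measurable_sum _ fun i _ => (h1 _).smul_const _

end Gradient

/-- Resampling one coordinate preserves a product measure. -/
lemma measurePreserving_update {ι : Type*} [Fintype ι] [DecidableEq ι] {α : ι → Type*}
    [∀ i, MeasurableSpace (α i)] (μ : ∀ i, Measure (α i)) [∀ i, IsProbabilityMeasure (μ i)]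
    (i : ι) :
    MeasurePreserving (fun p : (∀ j, α j) × α i => Function.update p.1 i p.2)
      ((Measure.pi μ).prod (μ i)) (Measure.pi μ) := by
  have hm : Measurable fun p : (∀ j, α j) × α i => Function.update p.1 i p.2 := by
    refine measurable_pi_iff.2 fun j => ?_
    rcases eq_or_ne j i with rfl | hj
    · simpa using measurable_snd
    · simpa [Function.update_of_ne hj, Function.comp_def] using
        (measurable_pi_apply j).comp (measurable_fst (α := ∀ j, α j) (β := α i))
  refine ⟨hm, (Measure.pi_eq fun s hs => ?_).symm⟩
  rw [Measure.map_apply hm (MeasurableSet.univ_pi hs)]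
  have h1 : (fun p : (∀ j, α j) × α i => Function.update p.1 i p.2) ⁻¹' (Set.univ.pi s) =
      (Set.univ.pi (Function.update s i Set.univ)) ×ˢ (s i) := by
    ext p
    simp only [Set.mem_preimage, Set.mem_univ_pi, Set.mem_prod]
    constructor
    · intro h
      refine ⟨fun j => ?_, by simpa using h i⟩
      rcases eq_or_ne j i with rfl | hj
      · simp
      · simpa [Function.update_of_ne hj] using h j
    · rintro ⟨h, h'⟩ j
      rcases eq_or_ne j i with rfl | hj
      · simpa using h'
      · simpa [Function.update_of_ne hj] using h j
  rw [h1, Measure.prod_prod, Measure.pi_pi, ← Finset.mul_prod_erase _ _ (Finset.mem_univ i),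
    ← Finset.mul_prod_erase _ (fun j => μ j (s j)) (Finset.mem_univ i)]
  simp only [Function.update_self, measure_univ, one_mul]
  rw [mul_comm]
  congr 1
  refine Finset.prod_congr rfl fun j hj => ?_
  rw [Function.update_of_ne (Finset.ne_of_mem_erase hj)]

/-! ### The parameters as a function of data, batches and noise -/

section Trajectory

variable {N d T : ℕ} {𝒲 𝒵 : Type*}

lemma gradient_empRisk {hyp : Param d → 𝒲} {ℓ : 𝒲 → 𝒵 → ℝ}
    (hd : ∀ z, Differentiable ℝ fun θ : Param d => ℓ (hyp θ) z) (S : Fin N → 𝒵)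
    (A : Finset (Fin N)) (θ : Param d) :
    ∇ (fun θ' => empRisk ℓ S A (hyp θ')) θ =
      (A.card : ℝ)⁻¹ • ∑ i ∈ A, ∇ (fun θ' => ℓ (hyp θ') (S i)) θ := by
  have h1 : HasFDerivAt (fun θ' => ∑ i ∈ A, ℓ (hyp θ') (S i))
      (∑ i ∈ A, fderiv ℝ (fun θ' => ℓ (hyp θ') (S i)) θ) θ :=
    HasFDerivAt.fun_sum fun i _ => (hd (S i) θ).hasFDerivAt
  have h2 : (fun θ' => empRisk ℓ S A (hyp θ')) =
      fun θ' => (A.card : ℝ)⁻¹ • ∑ i ∈ A, ℓ (hyp θ') (S i) := by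
    funext θ'
    rw [empRisk, div_eq_inv_mul, smul_eq_mul]
  rw [gradient, h2, (h1.fun_const_smul (A.card : ℝ)⁻¹).fderiv]
  simp [gradient]

/-- The parameter after a gradient step, before the noise is added. -/
def drift (hyp : Param d → 𝒲) (ℓ : 𝒲 → 𝒵 → ℝ) (r : ℝ) (S : Fin N → 𝒵) (A : Finset (Fin N))
    (θ : Param d) : Param d :=
  θ - r • ∇ (fun θ' => empRisk ℓ S A (hyp θ')) θ

/-- The parameters as a function of the dataset `S`, the batches `v`, the initialization `x` and the
noise `e` (constant after the last iteration). -/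
def iterate (hyp : Param d → 𝒲) (ℓ : 𝒲 → 𝒵 → ℝ) (η σ : Fin T → ℝ) (S : Fin N → 𝒵)
    (v : Fin T → Finset (Fin N)) (n : Param d × (Fin T → Param d)) : ℕ → Param d
  | 0 => n.1
  | t + 1 => if h : t < T then
      drift hyp ℓ (η ⟨t, h⟩) S (v ⟨t, h⟩) (iterate hyp ℓ η σ S v n t) + σ ⟨t, h⟩ • n.2 ⟨t, h⟩
    else iterate hyp ℓ η σ S v n t

/-- The parameters up to the time `t`. -/
def history (hyp : Param d → 𝒲) (ℓ : 𝒲 → 𝒵 → ℝ) (η σ : Fin T → ℝ) (S : Fin N → 𝒵)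
    (v : Fin T → Finset (Fin N)) (t : ℕ) (n : Param d × (Fin T → Param d)) :
    Fin (t + 1) → Param d :=
  fun k => iterate hyp ℓ η σ S v n k

/-- Causality in the batches; this is why conditioning on the past batches alone determines the law
of the past parameters. -/
lemma iterate_congr_batches (hyp : Param d → 𝒲) (ℓ : 𝒲 → 𝒵 → ℝ) (η σ : Fin T → ℝ)
    (S : Fin N → 𝒵) {v v' : Fin T → Finset (Fin N)} (n : Param d × (Fin T → Param d)) {t : ℕ}
    (h : ∀ k : Fin T, (k : ℕ) < t → v k = v' k) :
    iterate hyp ℓ η σ S v n t = iterate hyp ℓ η σ S v' n t := by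
  induction t with
  | zero => rfl
  | succ t ih =>
    have ih := ih fun k hk => h k (by omega)
    simp only [iterate, ih]
    split_ifs with ht
    · rw [h ⟨t, ht⟩ (Nat.lt_succ_self t)]
    · rfl

lemma history_congr_batches (hyp : Param d → 𝒲) (ℓ : 𝒲 → 𝒵 → ℝ) (η σ : Fin T → ℝ)
    (S : Fin N → 𝒵) {v v' : Fin T → Finset (Fin N)} {t : ℕ}
    (h : ∀ k : Fin T, (k : ℕ) < t → v k = v' k) :
    history hyp ℓ η σ S v t = history hyp ℓ η σ S v' t := by
  funext n k
  exact iterate_congr_batches hyp ℓ η σ S n fun i hi => h i (by omega)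

/-- Causality in the noise: step `i` first enters the parameter at time `i + 1`, so its noise can be
resampled without altering the past. -/
lemma iterate_update (hyp : Param d → 𝒲) (ℓ : 𝒲 → 𝒵 → ℝ) (η σ : Fin T → ℝ)
    (S : Fin N → 𝒵) (v : Fin T → Finset (Fin N)) (x : Param d) (e : Fin T → Param d)
    (i : Fin T) (y : Param d) {t : ℕ} (h : t ≤ i) :
    iterate hyp ℓ η σ S v (x, Function.update e i y) t = iterate hyp ℓ η σ S v (x, e) t := by
  induction t with
  | zero => rfl
  | succ t ih =>
    have ih := ih (by omega)
    have hne : ∀ ht : t < T, (⟨t, ht⟩ : Fin T) ≠ i := by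
      rintro ht rfl
      simp at h
    simp only [iterate, ih]
    split_ifs with ht
    · rw [Function.update_of_ne (hne ht)]
    · rfl

lemma history_succ (hyp : Param d → 𝒲) (ℓ : 𝒲 → 𝒵 → ℝ) (η σ : Fin T → ℝ)
    (S : Fin N → 𝒵) (v : Fin T → Finset (Fin N)) {t : ℕ} (ht : t < T)
    (x : Param d) (e : Fin T → Param d) (y : Param d) :
    history hyp ℓ η σ S v (t + 1) (x, Function.update e ⟨t, ht⟩ y) =
      extendPath (fun h => drift hyp ℓ (η ⟨t, ht⟩) S (v ⟨t, ht⟩) (h (Fin.last t))) (σ ⟨t, ht⟩)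
        (history hyp ℓ η σ S v t (x, e), y) := by
  funext k
  refine Fin.lastCases ?_ (fun k => ?_) k
  · simp only [extendPath, Fin.snoc_last, history, Fin.val_last]
    rw [iterate, dif_pos ht, iterate_update _ _ _ _ _ _ _ _ _ _ le_rfl]
    simp only [Function.update_self]
  · simp only [extendPath, Fin.snoc_castSucc, history, Fin.val_castSucc]
    exact iterate_update _ _ _ _ _ _ _ _ _ _ (Nat.lt_succ_iff.1 k.2)

variable [MeasurableSpace 𝒲] [MeasurableSpace 𝒵]

lemma measurable_gradient_loss {hyp : Param d → 𝒲} (hhyp : Measurable hyp) {ℓ : 𝒲 → 𝒵 → ℝ}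
    (hℓ : Measurable (Function.uncurry ℓ))
    (hd : ∀ z, Differentiable ℝ fun θ : Param d => ℓ (hyp θ) z) :
    Measurable fun p : 𝒵 × Param d => ∇ (fun θ => ℓ (hyp θ) p.1) p.2 := by
  refine measurable_gradient_of_param (f := fun z θ => ℓ (hyp θ) z) ?_ hd
  exact hℓ.comp ((hhyp.comp measurable_snd).prodMk measurable_fst)

lemma measurable_drift {hyp : Param d → 𝒲} (hhyp : Measurable hyp) {ℓ : 𝒲 → 𝒵 → ℝ}
    (hℓ : Measurable (Function.uncurry ℓ))
    (hd : ∀ z, Differentiable ℝ fun θ : Param d => ℓ (hyp θ) z) (r : ℝ) :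
    Measurable fun p : Finset (Fin N) × (Fin N → 𝒵) × Param d =>
      drift hyp ℓ r p.2.1 p.1 p.2.2 := by
  refine measurable_from_prod_countable_right fun A => ?_
  simp only [drift, gradient_empRisk hd]
  refine measurable_snd.sub
    ((Measurable.const_smul (Finset.measurable_fun_sum _ fun i _ => ?_) (A.card : ℝ)⁻¹).const_smul r)
  exact (measurable_gradient_loss hhyp hℓ hd).comp
    (by fun_prop : Measurable fun p : (Fin N → 𝒵) × Param d => (p.1 i, p.2))

lemma measurable_iterate {hyp : Param d → 𝒲} (hhyp : Measurable hyp) {ℓ : 𝒲 → 𝒵 → ℝ}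
    (hℓ : Measurable (Function.uncurry ℓ))
    (hd : ∀ z, Differentiable ℝ fun θ : Param d => ℓ (hyp θ) z) (η σ : Fin T → ℝ) (t : ℕ) :
    Measurable fun p : ((Fin N → 𝒵) × (Fin T → Finset (Fin N))) × Param d × (Fin T → Param d) =>
      iterate hyp ℓ η σ p.1.1 p.1.2 p.2 t := by
  induction t with
  | zero => exact measurable_fst.comp measurable_snd
  | succ t ih =>
    simp only [iterate]
    split_ifs with ht
    · refine Measurable.add ?_ ?_
      · exact (measurable_drift hhyp hℓ hd _).comp
          ((by fun_prop : Measurable fun p : ((Fin N → 𝒵) × (Fin T → Finset (Fin N))) × Param d ×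
            (Fin T → Param d) => p.1.2 ⟨t, ht⟩).prodMk
              ((measurable_fst.comp measurable_fst).prodMk ih))
      · fun_prop
    · exact ih

lemma measurable_history {hyp : Param d → 𝒲} (hhyp : Measurable hyp) {ℓ : 𝒲 → 𝒵 → ℝ}
    (hℓ : Measurable (Function.uncurry ℓ))
    (hd : ∀ z, Differentiable ℝ fun θ : Param d => ℓ (hyp θ) z) (η σ : Fin T → ℝ) (t : ℕ) :
    Measurable fun p : ((Fin N → 𝒵) × (Fin T → Finset (Fin N))) × Param d × (Fin T → Param d) =>
      history hyp ℓ η σ p.1.1 p.1.2 t p.2 :=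
  measurable_pi_iff.2 fun k => measurable_iterate hhyp hℓ hd η σ k

/-- The law of the parameters up to time `t + 1` is obtained from that up to time `t` by a Gaussian
step. -/
lemma map_history_succ {hyp : Param d → 𝒲} (hhyp : Measurable hyp) {ℓ : 𝒲 → 𝒵 → ℝ}
    (hℓ : Measurable (Function.uncurry ℓ))
    (hd : ∀ z, Differentiable ℝ fun θ : Param d => ℓ (hyp θ) z) (η σ : Fin T → ℝ)
    (S : Fin N → 𝒵) (v : Fin T → Finset (Fin N)) (ρ : Measure (Param d)) [IsProbabilityMeasure ρ]
    {t : ℕ} (ht : t < T) :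
    (ρ.prod (Measure.pi fun _ : Fin T => stdGaussian (Param d))).map
        (history hyp ℓ η σ S v (t + 1)) =
      (((ρ.prod (Measure.pi fun _ : Fin T => stdGaussian (Param d))).map
        (history hyp ℓ η σ S v t)).prod (stdGaussian (Param d))).map
          (extendPath (fun h => drift hyp ℓ (η ⟨t, ht⟩) S (v ⟨t, ht⟩) (h (Fin.last t)))
            (σ ⟨t, ht⟩)) := by
  have hmh : ∀ t, Measurable (history hyp ℓ η σ S v t) := fun t =>
    (measurable_history hhyp hℓ hd η σ t).comp
      ((measurable_const (a := (S, v))).prodMk measurable_id)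
  have hmd : Measurable fun h : Fin (t + 1) → Param d =>
      drift hyp ℓ (η ⟨t, ht⟩) S (v ⟨t, ht⟩) (h (Fin.last t)) :=
    (measurable_drift hhyp hℓ hd _).comp
      (by fun_prop : Measurable fun h : Fin (t + 1) → Param d => (v ⟨t, ht⟩, S, h (Fin.last t)))
  set γ := stdGaussian (Param d)
  -- Replacing the noise of step `t` by an independent copy keeps the law, and makes the new
  -- increment independent of the history by construction.
  have h1 : MeasurePreserving (fun p : (Param d × (Fin T → Param d)) × Param d =>
      (p.1.1, Function.update p.1.2 ⟨t, ht⟩ p.2))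
      ((ρ.prod (Measure.pi fun _ : Fin T => γ)).prod γ) (ρ.prod (Measure.pi fun _ : Fin T => γ)) :=
    ((MeasurePreserving.id ρ).prod (measurePreserving_update (fun _ : Fin T => γ) ⟨t, ht⟩)).comp
      (measurePreserving_prodAssoc ρ _ γ)
  conv_lhs => rw [← h1.map_eq, Measure.map_map (hmh _) h1.measurable]
  have h2 : (history hyp ℓ η σ S v (t + 1)) ∘ (fun p : (Param d × (Fin T → Param d)) × Param d =>
      (p.1.1, Function.update p.1.2 ⟨t, ht⟩ p.2)) =
      (extendPath (fun h => drift hyp ℓ (η ⟨t, ht⟩) S (v ⟨t, ht⟩) (h (Fin.last t)))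
            (σ ⟨t, ht⟩)) ∘ (Prod.map (history hyp ℓ η σ S v t) id) := by
    funext p
    exact history_succ hyp ℓ η σ S v ht p.1.1 p.1.2 p.2
  rw [h2, ← Measure.map_map (measurable_extendPath hmd _) ((hmh t).prodMap measurable_id),
    ← Measure.map_prod_map _ _ (hmh t) measurable_id, Measure.map_id]

end Trajectory

/-- The probability that a bit equals `b` if it equals `true` with probability `p`. -/
def bitWeight (b : Bool) (p : ℝ) : ℝ := if b then p else 1 - p

lemma bitWeight_not (b : Bool) (p : ℝ) : bitWeight (!b) p = 1 - bitWeight b p := by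
  cases b <;> simp [bitWeight]

lemma bitWeight_mem_Icc (b : Bool) {p : ℝ} (hp : p ∈ Set.Icc (0 : ℝ) 1) :
    bitWeight b p ∈ Set.Icc (0 : ℝ) 1 := by
  obtain ⟨h0, h1⟩ := hp
  cases b
  · exact ⟨by simpa [bitWeight] using h1, by simpa [bitWeight] using h0⟩
  · exact ⟨by simpa [bitWeight] using h0, by simpa [bitWeight] using h1⟩

/-- For a bit `b`, the absolute values `|b - p|` and `|(1 - p) - b|` are the weights of the wrong
and of the true value of the bit. -/
lemma mixtureTerm_bit {d : ℕ} (b : Bool) {p : ℝ} (hp : p ∈ Set.Icc (0 : ℝ) 1) (η σ : ℝ) (K : ℕ)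
    (ζ : Param d) : mixtureTerm (bit b) p η σ K ζ =
      mixtureCost (bitWeight b p) (η ^ 2 * ‖ζ‖ ^ 2 / (2 * σ ^ 2 * (K : ℝ) ^ 2)) := by
  obtain ⟨h0, h1⟩ := hp
  cases b
  · simp [mixtureTerm, mixtureCost, bitWeight, bit, abs_of_nonneg h0,
      abs_of_nonneg (sub_nonneg.2 h1)]
  · simp [mixtureTerm, mixtureCost, bitWeight, bit, abs_of_nonneg h0,
      abs_of_nonneg (sub_nonneg.2 h1)]

/-! ### Comparison of the two runs that differ in one bit -/

section Flip

variable {N d T : ℕ} {𝒲 𝒵 : Type*}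

/-- The bits with that of index `j` flipped. -/
def flipBit (j : Fin N) (u : Fin N → Bool) : Fin N → Bool := Function.update u j (!u j)

@[simp] lemma flipBit_self (j : Fin N) (u : Fin N → Bool) : flipBit j u j = !u j := by
  simp [flipBit]

lemma flipBit_of_ne {i j : Fin N} (h : i ≠ j) (u : Fin N → Bool) : flipBit j u i = u i := by
  simp [flipBit, h]

/-- A batch without `j` does not see the flipped bit. Such steps cost nothing, which restricts the
sum to the iterations that use `j`. -/
lemma drift_sub_drift_of_notMem {hyp : Param d → 𝒲} {ℓ : 𝒲 → 𝒵 → ℝ}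
    (hd : ∀ z, Differentiable ℝ fun θ : Param d => ℓ (hyp θ) z) (r : ℝ) (s : SuperSample N 𝒵)
    (u : Fin N → Bool) {j : Fin N} {A : Finset (Fin N)} (hj : j ∉ A) (θ : Param d) :
    drift hyp ℓ r (dataset s u) A θ - drift hyp ℓ r (dataset s (flipBit j u)) A θ = 0 := by
  rw [sub_eq_zero, drift, drift, gradient_empRisk hd, gradient_empRisk hd]
  congr 3
  refine Finset.sum_congr rfl fun i hi => ?_
  rw [dataset, dataset, flipBit_of_ne (by rintro rfl; exact hj hi)]

/-- Only the summand of index `j` differs between the two batch gradients; the value of the bit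
affects just the sign of the difference. -/
lemma norm_drift_sub_drift_of_mem {hyp : Param d → 𝒲} {ℓ : 𝒲 → 𝒵 → ℝ}
    (hd : ∀ z, Differentiable ℝ fun θ : Param d => ℓ (hyp θ) z) (r : ℝ) (s : SuperSample N 𝒵)
    (u : Fin N → Bool) {j : Fin N} {A : Finset (Fin N)} (hj : j ∈ A) (θ : Param d) :
    ‖drift hyp ℓ r (dataset s u) A θ - drift hyp ℓ r (dataset s (flipBit j u)) A θ‖ =
      |r| * (A.card : ℝ)⁻¹ * ‖incoherence hyp ℓ s j θ‖ := by
  have h1 : drift hyp ℓ r (dataset s u) A θ - drift hyp ℓ r (dataset s (flipBit j u)) A θ =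
      -(r • (A.card : ℝ)⁻¹ • (∇ (fun θ' => ℓ (hyp θ') (s j (u j))) θ -
        ∇ (fun θ' => ℓ (hyp θ') (s j (!u j))) θ)) := by
    rw [drift, drift, gradient_empRisk hd, gradient_empRisk hd, sub_sub_sub_cancel_left,
      ← smul_sub, ← smul_sub, ← Finset.sum_sub_distrib, ← smul_neg, ← smul_neg, neg_sub,
      Finset.sum_eq_single_of_mem j hj]
    · simp [dataset]
    · intro i _ hi
      simp [dataset, flipBit_of_ne hi]
  have h2 : ‖∇ (fun θ' => ℓ (hyp θ') (s j (u j))) θ - ∇ (fun θ' => ℓ (hyp θ') (s j (!u j))) θ‖ =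
      ‖incoherence hyp ℓ s j θ‖ := by
    rw [incoherence]
    cases u j
    · rfl
    · exact norm_sub_rev _ _
  rw [h1, norm_neg, norm_smul, norm_smul, h2, Real.norm_eq_abs, norm_inv, Real.norm_natCast]
  ring

/-- The mixture term of iteration `t` as a function of the bits, the super-sample, the batches and
the past parameters. -/
def stepCost (hyp : Param d → 𝒲) (ℓ : 𝒲 → 𝒵 → ℝ) (η σ : Fin T → ℝ)
    (π : (j : Fin N) → (t : Fin T) → EstimateInput N d T 𝒵 j t → ℝ) (j : Fin N) (t : Fin T)
    (s : SuperSample N 𝒵) (u : Fin N → Bool) (v : Fin T → Finset (Fin N))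
    (τ : Fin (t + 1) → Param d) : ℝ≥0∞ :=
  ENNReal.ofReal (mixtureTerm (bit (u j)) (π j t (fun i => u i, s, v, τ)) (η t) (σ t) (v t).card
    (incoherence hyp ℓ s j (τ (Fin.last t))))

variable [MeasurableSpace 𝒲] [MeasurableSpace 𝒵]

/-- The accumulated mixture terms, averaged over the noise. -/
def pathCost (hyp : Param d → 𝒲) (ℓ : 𝒲 → 𝒵 → ℝ) (η σ : Fin T → ℝ)
    (π : (j : Fin N) → (t : Fin T) → EstimateInput N d T 𝒵 j t → ℝ)
    (ν : Measure (Param d × (Fin T → Param d))) (j : Fin N)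
    (s : SuperSample N 𝒵) (u : Fin N → Bool) (v : Fin T → Finset (Fin N)) : ℝ≥0∞ :=
  ∑ t : Fin T with j ∈ v t, ∫⁻ τ, stepCost hyp ℓ η σ π j t s u v τ
    ∂(ν.map (history hyp ℓ η σ (dataset s u) v t))

/-- The loss of the final hypothesis on the unselected sample of index `j`, minus that on the
selected one. -/
def ghostGap (hyp : Param d → 𝒲) (ℓ : 𝒲 → 𝒵 → ℝ) (η σ : Fin T → ℝ) (j : Fin N)
    (s : SuperSample N 𝒵) (u : Fin N → Bool) (v : Fin T → Finset (Fin N))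
    (n : Param d × (Fin T → Param d)) : ℝ :=
  ℓ (hyp (iterate hyp ℓ η σ (dataset s u) v n T)) (s j (!u j)) -
    ℓ (hyp (iterate hyp ℓ η σ (dataset s u) v n T)) (s j (u j))

/-- The bound for the average of the gap over the two values of the bit `u j`, all else fixed. -/
lemma ofReal_integral_ghostGap_add_le {hyp : Param d → 𝒲} (hhyp : Measurable hyp)
    {ℓ : 𝒲 → 𝒵 → ℝ} (hℓ : Measurable (Function.uncurry ℓ))
    (hd : ∀ z, Differentiable ℝ fun θ : Param d => ℓ (hyp θ) z)
    {a b : ℝ} (hab : ∀ w z, ℓ w z ∈ Set.Icc a b) (η : Fin T → ℝ) {σ : Fin T → ℝ}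
    (hσ : ∀ t, 0 < σ t) {π : (j : Fin N) → (t : Fin T) → EstimateInput N d T 𝒵 j t → ℝ}
    (hπm : ∀ j t, Measurable (π j t)) (hπ : ∀ j t x, π j t x ∈ Set.Icc (0 : ℝ) 1)
    (ρ : Measure (Param d)) [IsProbabilityMeasure ρ] (j : Fin N)
    (s : SuperSample N 𝒵) (u : Fin N → Bool) (v : Fin T → Finset (Fin N)) :
    let ν := ρ.prod (Measure.pi fun _ : Fin T => stdGaussian (Param d))
    ENNReal.ofReal (∫ n, ghostGap hyp ℓ η σ j s u v n ∂ν +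
        ∫ n, ghostGap hyp ℓ η σ j s (flipBit j u) v n ∂ν) ≤
      ENNReal.ofReal (√2 * (b - a)) * (pathCost hyp ℓ η σ π ν j s u v ^ (1 / 2 : ℝ) +
        pathCost hyp ℓ η σ π ν j s (flipBit j u) v ^ (1 / 2 : ℝ)) := by
  intro ν
  have hmh : ∀ (S : Fin N → 𝒵) t, Measurable (history hyp ℓ η σ S v t) := fun S t =>
    (measurable_history hhyp hℓ hd η σ t).comp
      ((measurable_const (a := (S, v))).prodMk measurable_id)
  have hmd : ∀ (S : Fin N → 𝒵) (t : Fin T), Measurable fun h : Fin (t + 1) → Param d =>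
      drift hyp ℓ (η t) S (v t) (h (Fin.last t)) := fun S t =>
    (measurable_drift hhyp hℓ hd _).comp
      (by fun_prop : Measurable fun h : Fin (t + 1) → Param d => (v t, S, h (Fin.last t)))
  let M : (Fin N → Bool) → (t : ℕ) → Measure (Fin (t + 1) → Param d) := fun u t =>
    ν.map (history hyp ℓ η σ (dataset s u) v t)
  let m : (Fin N → Bool) → (t : ℕ) → (Fin (t + 1) → Param d) → Param d := fun u t h =>
    if ht : t < T then drift hyp ℓ (η ⟨t, ht⟩) (dataset s u) (v ⟨t, ht⟩) (h (Fin.last t)) else 0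
  let c : ℕ → ℝ := fun t => if ht : t < T then σ ⟨t, ht⟩ else 0
  -- The estimated probability of the actual bit `u j`, hence the weight of the run with bits `u`.
  -- The default values for `t ≥ T` are never used in the bound.
  let w : (t : ℕ) → (Fin (t + 1) → Param d) → ℝ := fun t h =>
    if ht : t < T then bitWeight (u j) (π j ⟨t, ht⟩ (fun i => u i, s, v, h)) else 0
  let g : (Fin (T + 1) → Param d) → ℝ := fun h =>
    ℓ (hyp (h (Fin.last T))) (s j (!u j)) - ℓ (hyp (h (Fin.last T))) (s j (u j))
  have hMp : ∀ u t, IsProbabilityMeasure (M u t) := fun u t =>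
    Measure.isProbabilityMeasure_map (hmh _ _).aemeasurable
  have hm : ∀ u t, Measurable (m u t) := by
    intro u t
    by_cases ht : t < T
    · simpa only [m, dif_pos ht] using hmd (dataset s u) ⟨t, ht⟩
    · simp only [m, dif_neg ht]
      exact measurable_const
  have hc : ∀ t < T, 0 < c t := by
    intro t ht
    simp only [c, dif_pos ht, hσ]
  have hw : ∀ t, Measurable (w t) := by
    intro t
    by_cases ht : t < T
    · simp only [w, dif_pos ht]
      have h1 : Measurable fun h : Fin (t + 1) → Param d =>
          π j ⟨t, ht⟩ (fun i => u i, s, v, h) :=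
        (hπm j ⟨t, ht⟩).comp (by fun_prop)
      unfold bitWeight
      split_ifs
      · exact h1
      · exact measurable_const.sub h1
    · simp only [w, dif_neg ht]
      exact measurable_const
  have hw1 : ∀ t h, w t h ∈ Set.Icc (0 : ℝ) 1 := by
    intro t h
    by_cases ht : t < T
    · simp only [w, dif_pos ht]
      exact bitWeight_mem_Icc _ (hπ _ _ _)
    · simp [w, dif_neg ht]
  have hM : ∀ u, ∀ t < T, M u (t + 1) =
      ((M u t).prod (stdGaussian (Param d))).map (extendPath (m u t) (c t)) := by
    intro u t ht
    simp only [M, m, c, dif_pos ht]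
    exact map_history_succ hhyp hℓ hd η σ (dataset s u) v ρ ht
  have h0 : M u 0 = M (flipBit j u) 0 := by
    refine congrArg (Measure.map · ν) (funext fun n => funext fun k => ?_)
    obtain rfl : k = 0 := Fin.ext (Nat.lt_one_iff.1 k.isLt)
    rfl
  have hgm : Measurable g := by
    have h1 : ∀ z, Measurable fun h : Fin (T + 1) → Param d => ℓ (hyp (h (Fin.last T))) z :=
      fun z => hℓ.comp
        ((hhyp.comp (measurable_pi_apply (Fin.last T))).prodMk (measurable_const (a := z)))
    exact (h1 _).sub (h1 _)
  have hgB : ∀ h, |g h| ≤ b - a := by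
    intro h
    have h1 := hab (hyp (h (Fin.last T))) (s j (!u j))
    have h2 := hab (hyp (h (Fin.last T))) (s j (u j))
    rw [abs_le]
    exact ⟨by simp only [g]; linarith [h1.1, h2.2], by simp only [g]; linarith [h1.2, h2.1]⟩
  have key := ofReal_integral_sub_integral_le (hMp u) (hMp (flipBit j u)) (hm u)
    (hm (flipBit j u)) hc hw hw1 h0 (hM u) (hM (flipBit j u)) hgm hgB
  have e1 : ∫ h, g h ∂(M u T) = ∫ n, ghostGap hyp ℓ η σ j s u v n ∂ν := by
    simp only [M]
    rw [integral_map (hmh _ _).aemeasurable hgm.aestronglyMeasurable]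
    rfl
  -- Flipping the bit exchanges selected and unselected sample, so the same `g` is minus the gap of
  -- the flipped run.
  have e2 : ∫ h, g h ∂(M (flipBit j u) T) =
      -∫ n, ghostGap hyp ℓ η σ j s (flipBit j u) v n ∂ν := by
    simp only [M]
    rw [integral_map (hmh _ _).aemeasurable hgm.aestronglyMeasurable, ← integral_neg]
    refine integral_congr_ae (ae_of_all _ fun n => ?_)
    simp [g, ghostGap, history]
  have hδ : ∀ (t : Fin T) (h : Fin (t + 1) → Param d), j ∈ v t →
      ‖m u t h - m (flipBit j u) t h‖ ^ 2 / (2 * c t ^ 2) =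
        η t ^ 2 * ‖incoherence hyp ℓ s j (h (Fin.last t))‖ ^ 2 /
          (2 * σ t ^ 2 * ((v t).card : ℝ) ^ 2) := by
    intro t h ht
    simp only [m, c, dif_pos t.isLt]
    rw [norm_drift_sub_drift_of_mem hd _ _ _ ht, mul_pow, mul_pow, sq_abs, inv_pow]
    have h1 := (hσ t).ne'
    have h2 : ((v t).card : ℝ) ≠ 0 := by
      exact_mod_cast (Finset.card_pos.2 ⟨j, ht⟩).ne'
    simp only [Fin.eta]
    field_simp
  have hδ0 : ∀ (t : Fin T) (h : Fin (t + 1) → Param d), j ∉ v t →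
      ‖m u t h - m (flipBit j u) t h‖ ^ 2 / (2 * c t ^ 2) = 0 := by
    intro t h ht
    simp only [m, dif_pos t.isLt]
    rw [drift_sub_drift_of_notMem hd _ _ _ ht]
    simp
  have e3 : ∑ t ∈ Finset.range T, ∫⁻ h, ENNReal.ofReal (mixtureCost (w t h)
      (‖m u t h - m (flipBit j u) t h‖ ^ 2 / (2 * c t ^ 2))) ∂(M u t) =
      pathCost hyp ℓ η σ π ν j s u v := by
    rw [Finset.sum_range, pathCost, Finset.sum_filter]
    refine Finset.sum_congr rfl fun t _ => ?_
    split_ifs with ht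
    · refine lintegral_congr fun h => ?_
      rw [hδ t h ht, stepCost, mixtureTerm_bit _ (hπ _ _ _)]
      simp only [w, dif_pos t.isLt]
    · simp_rw [hδ0 t _ ht, mixtureCost_zero]
      simp
  have e4 : ∑ t ∈ Finset.range T, ∫⁻ h, ENNReal.ofReal (mixtureCost (1 - w t h)
      (‖m u t h - m (flipBit j u) t h‖ ^ 2 / (2 * c t ^ 2))) ∂(M (flipBit j u) t) =
      pathCost hyp ℓ η σ π ν j s (flipBit j u) v := by
    rw [Finset.sum_range, pathCost, Finset.sum_filter]
    refine Finset.sum_congr rfl fun t _ => ?_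
    split_ifs with ht
    · refine lintegral_congr fun h => ?_
      -- The estimate does not use the bit of `j`, so both runs are measured against the same
      -- mixture.
      have h3 : (fun i : {i : Fin N // i ≠ j} => flipBit j u i) =
          fun i : {i : Fin N // i ≠ j} => u i :=
        funext fun (i : {i : Fin N // i ≠ j}) => flipBit_of_ne i.2 u
      rw [hδ t h ht, stepCost, mixtureTerm_bit _ (hπ _ _ _), flipBit_self, bitWeight_not, h3]
      simp only [w, dif_pos t.isLt]
    · simp_rw [hδ0 t _ ht, mixtureCost_zero]
      simp
  rw [e1, e2, e3, e4, sub_neg_eq_add] at key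
  exact key

end Flip

/-! ### Joint measurability of losses and costs -/

section Measurability

variable {N d T : ℕ} {𝒲 𝒵 : Type*} [MeasurableSpace 𝒲] [MeasurableSpace 𝒵]

lemma measurable_dataset : Measurable fun p : SuperSample N 𝒵 × (Fin N → Bool) =>
    dataset p.1 p.2 := by
  refine measurable_from_prod_countable_left fun u => ?_
  have h : ∀ i : Fin N, Measurable fun s : SuperSample N 𝒵 => s i (u i) := fun i => by fun_prop
  exact measurable_pi_iff.2 h

lemma measurable_history_dataset {hyp : Param d → 𝒲} (hhyp : Measurable hyp) {ℓ : 𝒲 → 𝒵 → ℝ}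
    (hℓ : Measurable (Function.uncurry ℓ))
    (hd : ∀ z, Differentiable ℝ fun θ : Param d => ℓ (hyp θ) z) (η σ : Fin T → ℝ) (t : ℕ) :
    Measurable fun p : (SuperSample N 𝒵 × (Fin N → Bool) × (Fin T → Finset (Fin N))) ×
      (Param d × (Fin T → Param d)) =>
      history hyp ℓ η σ (dataset p.1.1 p.1.2.1) p.1.2.2 t p.2 := by
  have h : Measurable fun p : (SuperSample N 𝒵 × (Fin N → Bool) × (Fin T → Finset (Fin N))) ×
      (Param d × (Fin T → Param d)) => ((dataset p.1.1 p.1.2.1, p.1.2.2), p.2) := by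
    refine Measurable.prodMk (Measurable.prodMk ?_ (by fun_prop)) measurable_snd
    exact measurable_dataset.comp (by fun_prop : Measurable fun p : (SuperSample N 𝒵 ×
      (Fin N → Bool) × (Fin T → Finset (Fin N))) × (Param d × (Fin T → Param d)) =>
        (p.1.1, p.1.2.1))
  exact (measurable_history hhyp hℓ hd η σ t).comp h

lemma measurable_final {hyp : Param d → 𝒲} (hhyp : Measurable hyp) {ℓ : 𝒲 → 𝒵 → ℝ}
    (hℓ : Measurable (Function.uncurry ℓ))
    (hd : ∀ z, Differentiable ℝ fun θ : Param d => ℓ (hyp θ) z) (η σ : Fin T → ℝ) :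
    Measurable fun p : (SuperSample N 𝒵 × (Fin N → Bool) × (Fin T → Finset (Fin N))) ×
      (Param d × (Fin T → Param d)) =>
      hyp (iterate hyp ℓ η σ (dataset p.1.1 p.1.2.1) p.1.2.2 p.2 T) := by
  have h := (measurable_pi_apply (Fin.last T)).comp
    (measurable_history_dataset (N := N) hhyp hℓ hd η σ T)
  exact hhyp.comp h

lemma measurable_sample (j : Fin N) (f : Bool → Bool) :
    Measurable fun p : SuperSample N 𝒵 × (Fin N → Bool) => p.1 j (f (p.2 j)) := by
  refine measurable_from_prod_countable_left fun u => ?_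
  simp only
  fun_prop

lemma measurable_loss_final {hyp : Param d → 𝒲} (hhyp : Measurable hyp) {ℓ : 𝒲 → 𝒵 → ℝ}
    (hℓ : Measurable (Function.uncurry ℓ))
    (hd : ∀ z, Differentiable ℝ fun θ : Param d => ℓ (hyp θ) z) (η σ : Fin T → ℝ) (j : Fin N)
    (f : Bool → Bool) :
    Measurable fun p : (SuperSample N 𝒵 × (Fin N → Bool) × (Fin T → Finset (Fin N))) ×
      (Param d × (Fin T → Param d)) =>
      ℓ (hyp (iterate hyp ℓ η σ (dataset p.1.1 p.1.2.1) p.1.2.2 p.2 T))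
        (p.1.1 j (f (p.1.2.1 j))) :=
  hℓ.comp ((measurable_final hhyp hℓ hd η σ).prodMk ((measurable_sample j f).comp
    (by fun_prop : Measurable fun p : (SuperSample N 𝒵 × (Fin N → Bool) ×
      (Fin T → Finset (Fin N))) × (Param d × (Fin T → Param d)) => (p.1.1, p.1.2.1))))

lemma measurable_ghostGap {hyp : Param d → 𝒲} (hhyp : Measurable hyp) {ℓ : 𝒲 → 𝒵 → ℝ}
    (hℓ : Measurable (Function.uncurry ℓ))
    (hd : ∀ z, Differentiable ℝ fun θ : Param d => ℓ (hyp θ) z) (η σ : Fin T → ℝ) (j : Fin N) :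
    Measurable fun p : (SuperSample N 𝒵 × (Fin N → Bool) × (Fin T → Finset (Fin N))) ×
      (Param d × (Fin T → Param d)) => ghostGap hyp ℓ η σ j p.1.1 p.1.2.1 p.1.2.2 p.2 :=
  (measurable_loss_final hhyp hℓ hd η σ j (fun b => !b)).sub
    (measurable_loss_final hhyp hℓ hd η σ j id)

lemma measurable_incoherence {hyp : Param d → 𝒲} (hhyp : Measurable hyp) {ℓ : 𝒲 → 𝒵 → ℝ}
    (hℓ : Measurable (Function.uncurry ℓ))
    (hd : ∀ z, Differentiable ℝ fun θ : Param d => ℓ (hyp θ) z) (j : Fin N) :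
    Measurable fun p : SuperSample N 𝒵 × Param d => incoherence hyp ℓ p.1 j p.2 :=
  ((measurable_gradient_loss hhyp hℓ hd).comp
    (by fun_prop : Measurable fun p : SuperSample N 𝒵 × Param d => (p.1 j false, p.2))).sub
  ((measurable_gradient_loss hhyp hℓ hd).comp
    (by fun_prop : Measurable fun p : SuperSample N 𝒵 × Param d => (p.1 j true, p.2)))

lemma measurable_stepCost {hyp : Param d → 𝒲} (hhyp : Measurable hyp) {ℓ : 𝒲 → 𝒵 → ℝ}
    (hℓ : Measurable (Function.uncurry ℓ))
    (hd : ∀ z, Differentiable ℝ fun θ : Param d => ℓ (hyp θ) z) (η σ : Fin T → ℝ)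
    {π : (j : Fin N) → (t : Fin T) → EstimateInput N d T 𝒵 j t → ℝ}
    (hπm : ∀ j t, Measurable (π j t)) (j : Fin N) (t : Fin T) :
    Measurable fun p : (SuperSample N 𝒵 × (Fin N → Bool) × (Fin T → Finset (Fin N))) ×
      (Fin (t + 1) → Param d) => stepCost hyp ℓ η σ π j t p.1.1 p.1.2.1 p.1.2.2 p.2 := by
  have h1 : Measurable fun p : (SuperSample N 𝒵 × (Fin N → Bool) × (Fin T → Finset (Fin N))) ×
      (Fin (t + 1) → Param d) => bit (p.1.2.1 j) :=
    (measurable_of_countable bit).comp (by fun_prop)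
  have h2 : Measurable fun p : (SuperSample N 𝒵 × (Fin N → Bool) × (Fin T → Finset (Fin N))) ×
      (Fin (t + 1) → Param d) =>
      π j t (fun i => p.1.2.1 i, p.1.1, p.1.2.2, p.2) :=
    (hπm j t).comp (by fun_prop)
  have h3 : Measurable fun p : (SuperSample N 𝒵 × (Fin N → Bool) × (Fin T → Finset (Fin N))) ×
      (Fin (t + 1) → Param d) => ((p.1.2.2 t).card : ℝ) :=
    (measurable_of_countable fun A : Finset (Fin N) => (A.card : ℝ)).comp
      (by fun_prop : Measurable fun p : (SuperSample N 𝒵 × (Fin N → Bool) ×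
        (Fin T → Finset (Fin N))) × (Fin (t + 1) → Param d) => p.1.2.2 t)
  have h4 : Measurable fun p : (SuperSample N 𝒵 × (Fin N → Bool) × (Fin T → Finset (Fin N))) ×
      (Fin (t + 1) → Param d) => ‖incoherence hyp ℓ p.1.1 j (p.2 (Fin.last t))‖ :=
    ((measurable_incoherence hhyp hℓ hd j).comp
      (by fun_prop : Measurable fun p : (SuperSample N 𝒵 × (Fin N → Bool) ×
        (Fin T → Finset (Fin N))) × (Fin (t + 1) → Param d) =>
          (p.1.1, p.2 (Fin.last t)))).norm
  unfold stepCost mixtureTerm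
  have h5 := (((h1.sub h2).abs.mul
    (((h4.pow_const 2).const_mul (η t ^ 2)).div
      ((h3.pow_const 2).const_mul (2 * σ t ^ 2))).neg.exp).add
    ((measurable_const (a := (1 : ℝ))).sub h2 |>.sub h1).abs).log.neg.ennreal_ofReal
  exact h5

lemma measurable_pathCost {hyp : Param d → 𝒲} (hhyp : Measurable hyp) {ℓ : 𝒲 → 𝒵 → ℝ}
    (hℓ : Measurable (Function.uncurry ℓ))
    (hd : ∀ z, Differentiable ℝ fun θ : Param d => ℓ (hyp θ) z) (η σ : Fin T → ℝ)
    {π : (j : Fin N) → (t : Fin T) → EstimateInput N d T 𝒵 j t → ℝ}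
    (hπm : ∀ j t, Measurable (π j t))
    (ν : Measure (Param d × (Fin T → Param d))) [SFinite ν] (j : Fin N) :
    Measurable fun p : SuperSample N 𝒵 × (Fin N → Bool) × (Fin T → Finset (Fin N)) =>
      pathCost hyp ℓ η σ π ν j p.1 p.2.1 p.2.2 := by
  simp only [pathCost, Finset.sum_filter]
  refine Finset.measurable_fun_sum _ fun t _ => ?_
  refine Measurable.ite ?_ ?_ measurable_const
  · exact (measurableSet_mem_finset j).preimage
      (by fun_prop : Measurable fun p : SuperSample N 𝒵 × (Fin N → Bool) ×
        (Fin T → Finset (Fin N)) => p.2.2 t)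
  · have hH := measurable_history_dataset (N := N) hhyp hℓ hd η σ t
    have hC := measurable_stepCost hhyp hℓ hd η σ hπm j t
    have hS := hC.comp (measurable_fst.prodMk hH)
    -- Moving the dependence on `p` from the measure into the integrand leaves an integral against
    -- the fixed measure `ν`.
    have h1 : ∀ p : SuperSample N 𝒵 × (Fin N → Bool) × (Fin T → Finset (Fin N)),
        ∫⁻ τ, stepCost hyp ℓ η σ π j t p.1 p.2.1 p.2.2 τ
          ∂(ν.map (history hyp ℓ η σ (dataset p.1 p.2.1) p.2.2 t)) =
        ∫⁻ n, stepCost hyp ℓ η σ π j t p.1 p.2.1 p.2.2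
          (history hyp ℓ η σ (dataset p.1 p.2.1) p.2.2 t n) ∂ν := by
      intro p
      have a0 : Measurable fun τ : Fin (t + 1) → Param d => (p, τ) := measurable_prodMk_left
      have a1 := hC.comp a0
      have a2 : Measurable (history hyp ℓ η σ (dataset p.1 p.2.1) p.2.2 t) :=
        hH.comp (measurable_prodMk_left (x := p))
      exact lintegral_map a1 a2
    simp_rw [h1]
    exact hS.lintegral_prod_right' (ν := ν)

end Measurability

/-! ### Flipping a bit and resampling a sample -/

section Symmetry

lemma measurePreserving_not : MeasurePreserving (fun b : Bool => !b)
    (uniformOn (Set.univ : Set Bool)) (uniformOn Set.univ) := by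
  refine ⟨measurable_of_countable _, Measure.ext_of_singleton fun b => ?_⟩
  rw [Measure.map_apply (measurable_of_countable _) (measurableSet_singleton b), uniformOn_univ,
    uniformOn_univ]
  have : (fun b : Bool => !b) ⁻¹' {b} = {!b} := by
    ext c
    cases b <;> cases c <;> simp
  rw [this, Measure.count_singleton, Measure.count_singleton]

lemma measurePreserving_flipBit {N : ℕ} (j : Fin N) :
    MeasurePreserving (flipBit j) (Measure.pi fun _ : Fin N => uniformOn (Set.univ : Set Bool))
      (Measure.pi fun _ => uniformOn Set.univ) := by
  have h := measurePreserving_pi (fun _ : Fin N => uniformOn (Set.univ : Set Bool))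
    (fun _ : Fin N => uniformOn (Set.univ : Set Bool))
    (f := fun i b => if i = j then !b else b) fun i => by
      by_cases hi : i = j
      · simpa [hi] using measurePreserving_not
      · simp only [hi, if_false]
        exact MeasurePreserving.id _
  convert h using 1
  funext u i
  by_cases hi : i = j
  · subst hi; simp
  · simp [flipBit_of_ne hi, hi]

/-- In a random super-sample one may resample an entry on which the rest does not depend. -/
lemma integral_superSample_eval {N : ℕ} {𝒵 : Type*} [MeasurableSpace 𝒵] (PZ : Measure 𝒵)
    [IsProbabilityMeasure PZ] (j : Fin N) (c : Bool) {F : SuperSample N 𝒵 → 𝒵 → ℝ}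
    (hF : Measurable (Function.uncurry F)) {C : ℝ} (hC : ∀ s z, |F s z| ≤ C)
    (hFi : ∀ s s' : SuperSample N 𝒵, (∀ i c', (i, c') ≠ (j, c) → s i c' = s' i c') → F s = F s') :
    let μ : Measure (SuperSample N 𝒵) := Measure.pi fun _ => Measure.pi fun _ => PZ
    ∫ s, F s (s j c) ∂μ = ∫ s, ∫ z, F s z ∂PZ ∂μ := by
  intro μ
  let μ₂ : Measure (Bool → 𝒵) := Measure.pi fun _ => PZ
  have h1 : MeasurePreserving (fun p : SuperSample N 𝒵 × (Bool → 𝒵) => Function.update p.1 j p.2)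
      (μ.prod μ₂) μ := measurePreserving_update (fun _ : Fin N => μ₂) j
  have h2 : MeasurePreserving (fun p : (Bool → 𝒵) × 𝒵 => Function.update p.1 c p.2)
      (μ₂.prod PZ) μ₂ := measurePreserving_update (fun _ : Bool => PZ) c
  have h3 : MeasurePreserving (fun p : (SuperSample N 𝒵 × (Bool → 𝒵)) × 𝒵 =>
      (Function.update p.1.1 j p.1.2, p.2)) ((μ.prod μ₂).prod PZ) (μ.prod PZ) :=
    h1.prod (MeasurePreserving.id PZ)
  have h4 : MeasurePreserving (fun p : (SuperSample N 𝒵 × (Bool → 𝒵)) × 𝒵 =>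
      Function.update p.1.1 j (Function.update p.1.2 c p.2)) ((μ.prod μ₂).prod PZ) μ :=
    (h1.comp ((MeasurePreserving.id μ).prod h2)).comp (measurePreserving_prodAssoc μ μ₂ PZ)
  have hm : Measurable fun s : SuperSample N 𝒵 => F s (s j c) :=
    hF.comp (by fun_prop : Measurable fun s : SuperSample N 𝒵 => (s, s j c))
  have hint : Integrable (Function.uncurry F) (μ.prod PZ) :=
    Integrable.of_bound hF.aestronglyMeasurable C (ae_of_all _ fun p => hC _ _)
  have e1 := integral_map h4.measurable.aemeasurable (μ := (μ.prod μ₂).prod PZ)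
    hm.aestronglyMeasurable
  have e2 := integral_map h3.measurable.aemeasurable (μ := (μ.prod μ₂).prod PZ)
    hF.aestronglyMeasurable
  rw [h4.map_eq] at e1
  rw [h3.map_eq, integral_prod _ hint] at e2
  -- Both sides are written with a resampled row `j`, and on the left its entry `c` is resampled
  -- once more. The two super-samples then differ only at `(j, c)`, which `F` ignores in its first
  -- argument.
  refine e1.trans (Eq.trans (integral_congr_ae (ae_of_all _ fun p => ?_)) e2.symm)
  simp only [Function.update_self, Function.uncurry]
  refine congrFun (hFi _ _ fun i c' hne => ?_) _
  by_cases hi : i = j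
  · subst hi
    have hc : c' ≠ c := fun h => hne (by rw [h])
    simp [hc]
  · simp [hi]

end Symmetry

/-- The right side integrates the positive part only. Without integrability the left side is zero by
convention. -/
lemma ofReal_integral_le_lintegral_ofReal {α : Type*} [MeasurableSpace α] {μ : Measure α}
    (f : α → ℝ) : ENNReal.ofReal (∫ x, f x ∂μ) ≤ ∫⁻ x, ENNReal.ofReal (f x) ∂μ := by
  by_cases hf : Integrable f μ
  · rw [integral_eq_lintegral_pos_part_sub_lintegral_neg_part hf]
    exact (ENNReal.ofReal_le_ofReal (sub_le_self _ ENNReal.toReal_nonneg)).trans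
      ENNReal.ofReal_toReal_le
  · simp [integral_undef hf]

/-- The conditional law of `H (X, Y)` given `X`, for independent `X` and `Y`. -/
lemma condDistrib_ae_eq_map_of_indep {Ω α β γ : Type*} [MeasurableSpace Ω] [MeasurableSpace α]
    [MeasurableSpace β] [MeasurableSpace γ] [StandardBorelSpace γ] [Nonempty γ] {P : Measure Ω}
    [IsFiniteMeasure P] {X : Ω → α} {Y : Ω → β} (hX : Measurable X) (hY : Measurable Y)
    {ν : Measure β} [IsProbabilityMeasure ν]
    (hlaw : P.map (fun ω => (X ω, Y ω)) = (P.map X).prod ν) {H : α × β → γ} (hH : Measurable H) :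
    ∀ᵐ x ∂(P.map X), condDistrib (fun ω => H (X ω, Y ω)) X P x = ν.map (fun y => H (x, y)) := by
  let κ : Kernel α γ := (Kernel.id ×ₖ Kernel.const α ν).map H
  have hκ : ∀ x, κ x = ν.map (fun y => H (x, y)) := by
    intro x
    simp only [κ]
    rw [Kernel.map_apply _ hH, Kernel.prod_apply, Kernel.id_apply, Kernel.const_apply, Measure.dirac_prod,
      Measure.map_map hH measurable_prodMk_left]
    rfl
  have : IsMarkovKernel κ := by
    refine ⟨fun x => ?_⟩
    rw [hκ]
    exact Measure.isProbabilityMeasure_map (hH.comp measurable_prodMk_left).aemeasurable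
  have h1 : P.map (fun ω => (X ω, H (X ω, Y ω))) = P.map X ⊗ₘ κ := by
    have hm : Measurable fun p : α × β => (p.1, H p) := measurable_fst.prodMk hH
    have h2 : P.map (fun ω => (X ω, H (X ω, Y ω))) =
        ((P.map X).prod ν).map (fun p => (p.1, H p)) := by
      rw [← hlaw, Measure.map_map hm (hX.prodMk hY)]
      rfl
    rw [h2]
    ext s hs
    rw [Measure.map_apply hm hs, Measure.prod_apply (hm hs), Measure.compProd_apply hs]
    refine lintegral_congr fun x => ?_
    have h3 : Measurable fun y => H (x, y) := hH.comp measurable_prodMk_left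
    rw [hκ, Measure.map_apply h3 (measurable_prodMk_left hs)]
    rfl
  have h2 := condDistrib_ae_eq_of_measure_eq_compProd X
    (hH.comp (hX.prodMk hY)).aemeasurable (κ := κ) h1
  filter_upwards [h2] with x hx
  rw [← hκ]
  exact hx

lemma lintegral_uniformOn_univ {N : ℕ} (f : Fin N → ℝ≥0∞) :
    ∫⁻ j, f j ∂(uniformOn Set.univ) = (N : ℝ≥0∞)⁻¹ * ∑ j, f j := by
  rw [lintegral_fintype, Finset.mul_sum]
  refine Finset.sum_congr rfl fun j _ => ?_
  rw [uniformOn_univ, Measure.count_singleton, Fintype.card_fin, one_div, mul_comm]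

/-! ### Marginals of the independent sources of randomness -/

section Environment

variable {α β γ δ ε : Type*} [MeasurableSpace α] [MeasurableSpace β] [MeasurableSpace γ]
  [MeasurableSpace δ] [MeasurableSpace ε] (μ₁ : Measure α) (μ₂ : Measure β) (μ₃ : Measure γ)
  (μ₄ : Measure δ) (μ₅ : Measure ε) [IsProbabilityMeasure μ₁] [IsProbabilityMeasure μ₂]
  [IsProbabilityMeasure μ₃] [IsProbabilityMeasure μ₄] [IsProbabilityMeasure μ₅]

/-- Integrates out the random index and separates the data from initialization and noise. -/
lemma measurePreserving_drop_third :
    MeasurePreserving (fun p : α × β × γ × δ × ε => ((p.1, p.2.1, p.2.2.2.1), p.2.2.2.2))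
      (μ₁.prod (μ₂.prod (μ₃.prod (μ₄.prod μ₅)))) ((μ₁.prod (μ₂.prod μ₄)).prod μ₅) := by
  have h1 := (MeasurePreserving.id μ₁).prod ((MeasurePreserving.id μ₂).prod
    (measurePreserving_snd (μ := μ₃) (ν := μ₄.prod μ₅)))
  have h2 := (MeasurePreserving.id μ₁).prod
    (MeasurePreserving.symm _ (measurePreserving_prodAssoc μ₂ μ₄ μ₅))
  have h3 := MeasurePreserving.symm _ (measurePreserving_prodAssoc μ₁ (μ₂.prod μ₄) μ₅)
  exact (h3.comp h2).comp h1

/-- Integrates out initialization and noise and brings the random index to the front. -/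
lemma measurePreserving_third_first :
    MeasurePreserving (fun p : α × β × γ × δ × ε => (p.2.2.1, p.1, p.2.1, p.2.2.2.1))
      (μ₁.prod (μ₂.prod (μ₃.prod (μ₄.prod μ₅)))) (μ₃.prod (μ₁.prod (μ₂.prod μ₄))) := by
  have h1 := (MeasurePreserving.id μ₁).prod ((MeasurePreserving.id μ₂).prod
    ((MeasurePreserving.id μ₃).prod (measurePreserving_fst (μ := μ₄) (ν := μ₅))))
  have h2 := (MeasurePreserving.id μ₁).prod
    (MeasurePreserving.symm _ (measurePreserving_prodAssoc μ₂ μ₃ μ₄))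
  have h3 := (MeasurePreserving.id μ₁).prod
    ((Measure.measurePreserving_swap (μ := μ₂) (ν := μ₃)).prod (MeasurePreserving.id μ₄))
  have h4 := (MeasurePreserving.id μ₁).prod (measurePreserving_prodAssoc μ₃ μ₂ μ₄)
  have h5 := MeasurePreserving.symm _ (measurePreserving_prodAssoc μ₁ μ₃ (μ₂.prod μ₄))
  have h6 := (Measure.measurePreserving_swap (μ := μ₁) (ν := μ₃)).prod
    (MeasurePreserving.id (μ₂.prod μ₄))
  have h7 := measurePreserving_prodAssoc μ₃ μ₁ (μ₂.prod μ₄)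
  exact ((((((h7.comp h6).comp h5).comp h4).comp h3).comp h2).comp h1)

end Environment

/-! ### Averaging the gap over the data and the index -/

section Gap

variable {N d T : ℕ} {𝒲 𝒵 : Type*} [MeasurableSpace 𝒲] [MeasurableSpace 𝒵]

/-- The bound for the gap of a fixed index, averaged over all the randomness. -/
lemma ofReal_integral_ghostGap_le {hyp : Param d → 𝒲} (hhyp : Measurable hyp)
    {ℓ : 𝒲 → 𝒵 → ℝ} (hℓ : Measurable (Function.uncurry ℓ))
    (hd : ∀ z, Differentiable ℝ fun θ : Param d => ℓ (hyp θ) z)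
    {a b : ℝ} (hab : ∀ w z, ℓ w z ∈ Set.Icc a b) (η : Fin T → ℝ) {σ : Fin T → ℝ}
    (hσ : ∀ t, 0 < σ t) {π : (j : Fin N) → (t : Fin T) → EstimateInput N d T 𝒵 j t → ℝ}
    (hπm : ∀ j t, Measurable (π j t)) (hπ : ∀ j t x, π j t x ∈ Set.Icc (0 : ℝ) 1)
    (ρ : Measure (Param d)) [IsProbabilityMeasure ρ] (j : Fin N)
    (μS : Measure (SuperSample N 𝒵)) [IsProbabilityMeasure μS]
    (μV : Measure (Fin T → Finset (Fin N))) [IsProbabilityMeasure μV] :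
    let ν := ρ.prod (Measure.pi fun _ : Fin T => stdGaussian (Param d))
    let Λ := μS.prod ((Measure.pi fun _ : Fin N => uniformOn (Set.univ : Set Bool)).prod μV)
    ENNReal.ofReal (∫ p, ghostGap hyp ℓ η σ j p.1.1 p.1.2.1 p.1.2.2 p.2 ∂(Λ.prod ν)) ≤
      ENNReal.ofReal (√2 * (b - a)) *
        ∫⁻ p, pathCost hyp ℓ η σ π ν j p.1 p.2.1 p.2.2 ^ (1 / 2 : ℝ) ∂Λ := by
  intro ν Λ
  have hgB : ∀ s u v n, |ghostGap hyp ℓ η σ j s u v n| ≤ b - a := by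
    intro s u v n
    have h1 := hab (hyp (iterate hyp ℓ η σ (dataset s u) v n T)) (s j (!u j))
    have h2 := hab (hyp (iterate hyp ℓ η σ (dataset s u) v n T)) (s j (u j))
    rw [abs_le, ghostGap]
    exact ⟨by linarith [h1.1, h2.2], by linarith [h1.2, h2.1]⟩
  have hgm := measurable_ghostGap (N := N) hhyp hℓ hd η σ j
  have hgi : Integrable (fun p : (SuperSample N 𝒵 × (Fin N → Bool) × (Fin T → Finset (Fin N))) ×
      (Param d × (Fin T → Param d)) => ghostGap hyp ℓ η σ j p.1.1 p.1.2.1 p.1.2.2 p.2)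
      (Λ.prod ν) :=
    Integrable.of_bound hgm.aestronglyMeasurable (b - a) (ae_of_all _ fun p => hgB _ _ _ _)
  let Φ : SuperSample N 𝒵 × (Fin N → Bool) × (Fin T → Finset (Fin N)) →
      SuperSample N 𝒵 × (Fin N → Bool) × (Fin T → Finset (Fin N)) :=
    Prod.map id (Prod.map (flipBit j) id)
  have hΦ : MeasurePreserving Φ Λ Λ :=
    (MeasurePreserving.id μS).prod ((measurePreserving_flipBit j).prod (MeasurePreserving.id μV))
  let G : SuperSample N 𝒵 × (Fin N → Bool) × (Fin T → Finset (Fin N)) → ℝ := fun p =>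
    ∫ n, ghostGap hyp ℓ η σ j p.1 p.2.1 p.2.2 n ∂ν
  have hGi : Integrable G Λ := hgi.integral_prod_left
  have hGΦi : Integrable (fun p => G (Φ p)) Λ := (hΦ.integrable_comp hGi.1).2 hGi
  have hGm : Measurable G := (hgm.stronglyMeasurable.integral_prod_right' (ν := ν)).measurable
  let K : SuperSample N 𝒵 × (Fin N → Bool) × (Fin T → Finset (Fin N)) → ℝ≥0∞ := fun p =>
    pathCost hyp ℓ η σ π ν j p.1 p.2.1 p.2.2 ^ (1 / 2 : ℝ)
  have hKm : Measurable K := (measurable_pathCost hhyp hℓ hd η σ hπm ν j).pow_const _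
  have e1 : ∫ p, ghostGap hyp ℓ η σ j p.1.1 p.1.2.1 p.1.2.2 p.2 ∂(Λ.prod ν) = ∫ p, G p ∂Λ :=
    integral_prod _ hgi
  have e2 : ∫ p, G (Φ p) ∂Λ = ∫ p, G p ∂Λ := by
    rw [← integral_map hΦ.measurable.aemeasurable hGm.aestronglyMeasurable, hΦ.map_eq]
  -- Symmetrization over the bit: the flip preserves `Λ`. The factor one half is later compensated
  -- by the two equal cost terms on the right.
  have e3 : ∫ p, G p ∂Λ = 2⁻¹ * ∫ p, (G p + G (Φ p)) ∂Λ := by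
    rw [integral_add hGi hGΦi, e2]
    ring
  have e4 : ∫⁻ p, K (Φ p) ∂Λ = ∫⁻ p, K p ∂Λ := hΦ.lintegral_comp hKm
  have h1 : ENNReal.ofReal (∫ p, (G p + G (Φ p)) ∂Λ) ≤
      ∫⁻ p, ENNReal.ofReal (√2 * (b - a)) * (K p + K (Φ p)) ∂Λ := by
    refine (ofReal_integral_le_lintegral_ofReal _).trans (lintegral_mono fun p => ?_)
    exact ofReal_integral_ghostGap_add_le hhyp hℓ hd hab η hσ hπm hπ ρ j p.1 p.2.1 p.2.2
  have hKΦ : Measurable fun p => K p + K (Φ p) := hKm.add (hKm.comp hΦ.measurable)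
  rw [lintegral_const_mul _ hKΦ, lintegral_add_left hKm, e4,
    ← two_mul] at h1
  rw [e1, e3, ENNReal.ofReal_mul (by norm_num)]
  calc _ ≤ ENNReal.ofReal 2⁻¹ * (ENNReal.ofReal (√2 * (b - a)) * (2 * ∫⁻ p, K p ∂Λ)) := by gcongr
    _ = (ENNReal.ofReal 2⁻¹ * 2) * (ENNReal.ofReal (√2 * (b - a)) * ∫⁻ p, K p ∂Λ) := by ring
    _ = _ := by
      rw [ENNReal.ofReal_inv_of_pos (by norm_num), ENNReal.ofReal_ofNat,
        ENNReal.inv_mul_cancel (by norm_num) (by norm_num), one_mul]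

/-- The expected generalization error is the average over the index of the expected gap. -/
lemma integral_gen_eq (hN : N ≠ 0) {hyp : Param d → 𝒲} (hhyp : Measurable hyp)
    {ℓ : 𝒲 → 𝒵 → ℝ} (hℓ : Measurable (Function.uncurry ℓ))
    (hd : ∀ z, Differentiable ℝ fun θ : Param d => ℓ (hyp θ) z)
    {a b : ℝ} (hab : ∀ w z, ℓ w z ∈ Set.Icc a b) (η σ : Fin T → ℝ)
    (PZ : Measure 𝒵) [IsProbabilityMeasure PZ]
    (μB : Measure ((Fin N → Bool) × (Fin T → Finset (Fin N)))) [IsProbabilityMeasure μB]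
    (ν : Measure (Param d × (Fin T → Param d))) [IsProbabilityMeasure ν] :
    let Λ := (Measure.pi fun _ : Fin N => Measure.pi fun _ : Bool => PZ).prod μB
    ∫ p, gen ℓ PZ (hyp (iterate hyp ℓ η σ (dataset p.1.1 p.1.2.1) p.1.2.2 p.2 T))
        (dataset p.1.1 p.1.2.1) ∂(Λ.prod ν) =
      (N : ℝ)⁻¹ * ∑ j, ∫ p, ghostGap hyp ℓ η σ j p.1.1 p.1.2.1 p.1.2.2 p.2 ∂(Λ.prod ν) := by
  intro Λ
  let W : (SuperSample N 𝒵 × (Fin N → Bool) × (Fin T → Finset (Fin N))) ×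
      (Param d × (Fin T → Param d)) → 𝒲 := fun p =>
    hyp (iterate hyp ℓ η σ (dataset p.1.1 p.1.2.1) p.1.2.2 p.2 T)
  have hW : Measurable W := measurable_final hhyp hℓ hd η σ
  have hC : ∀ w z, |ℓ w z| ≤ max |a| |b| := fun w z => abs_le_max_abs_abs (hab w z).1 (hab w z).2
  have hpop : Measurable fun p => popRisk ℓ PZ (W p) := by
    have h1 : Measurable fun w => popRisk ℓ PZ w :=
      (hℓ.stronglyMeasurable.integral_prod_right' (ν := PZ)).measurable
    exact h1.comp hW
  have hpopb : ∀ w, |popRisk ℓ PZ w| ≤ max |a| |b| := by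
    intro w
    have := norm_integral_le_of_norm_le_const (μ := PZ)
      (ae_of_all _ fun z => (by exact hC w z : ‖ℓ w z‖ ≤ max |a| |b|))
    simpa [popRisk] using this
  have hpopi : Integrable (fun p => popRisk ℓ PZ (W p)) (Λ.prod ν) :=
    Integrable.of_bound hpop.aestronglyMeasurable _ (ae_of_all _ fun p => hpopb _)
  have hli : ∀ (j : Fin N) (f : Bool → Bool),
      Integrable (fun p => ℓ (W p) (p.1.1 j (f (p.1.2.1 j)))) (Λ.prod ν) := fun j f =>
    Integrable.of_bound (measurable_loss_final hhyp hℓ hd η σ j f).aestronglyMeasurable _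
      (ae_of_all _ fun p => hC _ _)
  have key : ∀ j, ∫ p, ℓ (W p) (p.1.1 j (!p.1.2.1 j)) ∂(Λ.prod ν) =
      ∫ p, popRisk ℓ PZ (W p) ∂(Λ.prod ν) := by
    intro j
    have hli' := hli j (fun b => !b)
    rw [integral_prod_symm _ hli', integral_prod_symm _ hpopi]
    refine integral_congr_ae ?_
    filter_upwards [hli'.prod_left_ae, hpopi.prod_left_ae] with n h1 h2
    rw [integral_prod_symm _ h1, integral_prod_symm _ h2]
    refine integral_congr_ae (ae_of_all _ fun q => ?_)
    have hW' : Measurable fun s : SuperSample N 𝒵 => W ((s, q), n) :=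
      hW.comp (by fun_prop : Measurable fun s : SuperSample N 𝒵 => ((s, q), n))
    -- With bits, batches and noise fixed, the output ignores the entry `(j, !q.1 j)`, so the loss
    -- there averages to the population risk.
    refine integral_superSample_eval PZ j (!q.1 j)
      (F := fun s z => ℓ (W ((s, q), n)) z) ?_ (fun s z => hC _ _) ?_
    · exact hℓ.comp ((hW'.comp measurable_fst).prodMk measurable_snd)
    · intro s s' hs
      have : dataset s q.1 = dataset s' q.1 := by
        funext i
        refine hs i _ fun h => ?_
        simp only [Prod.mk.injEq] at h
        obtain ⟨rfl, h⟩ := h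
        simp at h
      simp only [W, this]
  have h1 : ∀ j, ∫ p, ghostGap hyp ℓ η σ j p.1.1 p.1.2.1 p.1.2.2 p.2 ∂(Λ.prod ν) =
      ∫ p, popRisk ℓ PZ (W p) - ℓ (W p) (p.1.1 j (p.1.2.1 j)) ∂(Λ.prod ν) := by
    intro j
    refine Eq.trans ?_ (integral_sub hpopi (hli j id)).symm
    rw [← key j]
    exact integral_sub (hli j (fun b => !b)) (hli j id)
  simp_rw [h1]
  have h2 : ∀ j : Fin N, Integrable
      (fun p => popRisk ℓ PZ (W p) - ℓ (W p) (p.1.1 j (p.1.2.1 j))) (Λ.prod ν) :=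
    fun j => hpopi.sub (hli j id)
  rw [← integral_finsetSum _ fun j _ => h2 j, ← integral_const_mul]
  refine integral_congr_ae (ae_of_all _ fun p => ?_)
  have hN' : (N : ℝ) ≠ 0 := by exact_mod_cast hN
  simp only [gen, empRisk, Finset.sum_sub_distrib, Finset.sum_const, Finset.card_univ,
    Fintype.card_fin, nsmul_eq_mul, mul_sub, inv_mul_cancel_left₀ hN', dataset, W]
  rw [div_eq_inv_mul]

end Gap

/-! ### Laws and conditional laws of the random algorithm -/

variable {Ω 𝒲 𝒵 : Type*} [MeasurableSpace Ω] [MeasurableSpace 𝒵]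
  {N d T : ℕ} {P : Measure Ω} {PZ : Measure 𝒵} {hyp : Param d → 𝒲} {ℓ : 𝒲 → 𝒵 → ℝ}
  {η σ : Fin T → ℝ} {St : Ω → SuperSample N 𝒵} {U : Ω → Fin N → Bool} {J : Ω → Fin N}
  {V : Ω → Fin T → Finset (Fin N)} {ε : Ω → Fin T → Param d} {θ : Fin (T + 1) → Ω → Param d}

lemma IsSGLD.eq_iterate (h : IsSGLD P PZ hyp ℓ η σ St U J V ε θ) (k : Fin (T + 1)) (ω : Ω) :
    θ k ω = iterate hyp ℓ η σ (dataset (St ω) (U ω)) (V ω) (θ 0 ω, ε ω) k := by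
  induction k using Fin.induction with
  | zero => rfl
  | succ k ih =>
    rw [h.update, ih, Fin.val_succ, iterate, dif_pos k.isLt]
    rfl

variable [IsProbabilityMeasure P]

lemma IsSGLD.law_env (h : IsSGLD P PZ hyp ℓ η σ St U J V ε θ) :
    P.map (fun ω => ((St ω, U ω, V ω), (θ 0 ω, ε ω))) =
      ((Measure.pi fun _ => Measure.pi fun _ => PZ).prod
        ((Measure.pi fun _ => uniformOn Set.univ).prod (P.map V))).prod
        ((P.map (θ 0)).prod (Measure.pi fun _ => stdGaussian (Param d))) := by
  have := Measure.isProbabilityMeasure_map (μ := P) h.measurable_St.aemeasurable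
  have := Measure.isProbabilityMeasure_map (μ := P) h.measurable_U.aemeasurable
  have := Measure.isProbabilityMeasure_map (μ := P) h.measurable_J.aemeasurable
  have := Measure.isProbabilityMeasure_map (μ := P) h.measurable_V.aemeasurable
  have := Measure.isProbabilityMeasure_map (μ := P) h.measurable_init.aemeasurable
  have := Measure.isProbabilityMeasure_map (μ := P) h.measurable_ε.aemeasurable
  have h1 := measurePreserving_drop_third (P.map St) (P.map U) (P.map J) (P.map V)
    ((P.map (θ 0)).prod (P.map ε))
  have h2 := h1.map_eq
  rw [← h.indep, Measure.map_map h1.measurable (h.measurable_St.prodMk (h.measurable_U.prodMk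
    (h.measurable_J.prodMk (h.measurable_V.prodMk (h.measurable_init.prodMk h.measurable_ε))))),
    h.law_St, h.law_U, h.law_ε] at h2
  exact h2

lemma IsSGLD.law_index (h : IsSGLD P PZ hyp ℓ η σ St U J V ε θ) :
    P.map (fun ω => (J ω, (St ω, U ω, V ω))) = (uniformOn Set.univ).prod
      ((Measure.pi fun _ => Measure.pi fun _ => PZ).prod
        ((Measure.pi fun _ => uniformOn Set.univ).prod (P.map V))) := by
  have := Measure.isProbabilityMeasure_map (μ := P) h.measurable_St.aemeasurable
  have := Measure.isProbabilityMeasure_map (μ := P) h.measurable_U.aemeasurable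
  have := Measure.isProbabilityMeasure_map (μ := P) h.measurable_J.aemeasurable
  have := Measure.isProbabilityMeasure_map (μ := P) h.measurable_V.aemeasurable
  have := Measure.isProbabilityMeasure_map (μ := P) h.measurable_init.aemeasurable
  have := Measure.isProbabilityMeasure_map (μ := P) h.measurable_ε.aemeasurable
  have h1 := measurePreserving_third_first (P.map St) (P.map U) (P.map J) (P.map V)
    ((P.map (θ 0)).prod (P.map ε))
  have h2 := h1.map_eq
  rw [← h.indep, Measure.map_map h1.measurable (h.measurable_St.prodMk (h.measurable_U.prodMk
    (h.measurable_J.prodMk (h.measurable_V.prodMk (h.measurable_init.prodMk h.measurable_ε))))),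
    h.law_St, h.law_U, h.law_J] at h2
  exact h2

/-- The batches with a given past and no samples from time `t` on. -/
def extendBatches (t : Fin T) (v : Fin t → Finset (Fin N)) : Fin T → Finset (Fin N) :=
  fun k => if h : (k : ℕ) < t then v ⟨k, h⟩ else ∅

variable [MeasurableSpace 𝒲] [IsProbabilityMeasure PZ]

/-- The conditional law of the past parameters is that of the parameters computed from the given
data with fresh noise. -/
lemma IsSGLD.trajectoryLaw_ae_eq (h : IsSGLD P PZ hyp ℓ η σ St U J V ε θ) (hhyp : Measurable hyp)
    (hℓ : Measurable (Function.uncurry ℓ))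
    (hd : ∀ z, Differentiable ℝ fun θ : Param d => ℓ (hyp θ) z) (t : Fin T) :
    ∀ᵐ ω ∂P, trajectoryLaw P St U V θ t (U ω, St ω, pastBatches (V ω) t) =
      ((P.map (θ 0)).prod (Measure.pi fun _ => stdGaussian (Param d))).map
        (history hyp ℓ η σ (dataset (St ω) (U ω)) (V ω) t) := by
  have := Measure.isProbabilityMeasure_map (μ := P) h.measurable_V.aemeasurable
  have := Measure.isProbabilityMeasure_map (μ := P) h.measurable_init.aemeasurable
  set ν := (P.map (θ 0)).prod (Measure.pi fun _ : Fin T => stdGaussian (Param d))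
  let X : Ω → (Fin N → Bool) × SuperSample N 𝒵 × (Fin t → Finset (Fin N)) := fun ω =>
    (U ω, St ω, pastBatches (V ω) t)
  let Y : Ω → Param d × (Fin T → Param d) := fun ω => (θ 0 ω, ε ω)
  have hY : Measurable Y := h.measurable_init.prodMk h.measurable_ε
  let q : SuperSample N 𝒵 × (Fin N → Bool) × (Fin T → Finset (Fin N)) →
      (Fin N → Bool) × SuperSample N 𝒵 × (Fin t → Finset (Fin N)) := fun p =>
    (p.2.1, p.1, pastBatches p.2.2 t)
  have hq : Measurable q := by
    have : Measurable fun v : Fin T → Finset (Fin N) => pastBatches v t :=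
      measurable_of_countable _
    exact (by fun_prop : Measurable fun p : SuperSample N 𝒵 × (Fin N → Bool) ×
      (Fin T → Finset (Fin N)) => p.2.1).prodMk (measurable_fst.prodMk
        (this.comp (measurable_snd.comp measurable_snd)))
  have henv : Measurable fun ω => (St ω, U ω, V ω) :=
    h.measurable_St.prodMk (h.measurable_U.prodMk h.measurable_V)
  have hX : Measurable X := hq.comp henv
  have hlaw : P.map (fun ω => (X ω, Y ω)) = (P.map X).prod ν := by
    have h1 := h.law_env
    set Λ := (Measure.pi fun _ : Fin N => Measure.pi fun _ : Bool => PZ).prod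
        ((Measure.pi fun _ : Fin N => uniformOn (Set.univ : Set Bool)).prod (P.map V))
    have h2 : P.map (fun ω => (St ω, U ω, V ω)) = Λ := by
      have h3 := congrArg (Measure.map Prod.fst) h1
      rw [Measure.map_map measurable_fst (henv.prodMk hY), Measure.map_fst_prod, measure_univ,
        one_smul] at h3
      exact h3
    have h4 : P.map X = Λ.map q := by
      rw [← h2, Measure.map_map hq henv]
      rfl
    have h5 : P.map (fun ω => (X ω, Y ω)) =
        (P.map (fun ω => ((St ω, U ω, V ω), (θ 0 ω, ε ω)))).map (Prod.map q id) := by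
      rw [Measure.map_map (hq.prodMap measurable_id) (henv.prodMk hY)]
      rfl
    rw [h5, h1, h4, ← Measure.map_prod_map _ _ hq measurable_id, Measure.map_id]
  let H : ((Fin N → Bool) × SuperSample N 𝒵 × (Fin t → Finset (Fin N))) ×
      (Param d × (Fin T → Param d)) → Fin (t + 1) → Param d := fun p =>
    history hyp ℓ η σ (dataset p.1.2.1 p.1.1) (extendBatches t p.1.2.2) t p.2
  have hH : Measurable H := by
    have h1 : Measurable fun v : Fin t → Finset (Fin N) => extendBatches t v :=
      measurable_of_countable _
    have h2 : Measurable fun p : ((Fin N → Bool) × SuperSample N 𝒵 × (Fin t → Finset (Fin N))) ×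
        (Param d × (Fin T → Param d)) =>
        ((p.1.2.1, p.1.1, extendBatches t p.1.2.2), p.2) := by
      refine Measurable.prodMk (Measurable.prodMk (by fun_prop) (Measurable.prodMk (by fun_prop) ?_))
        measurable_snd
      exact h1.comp (measurable_snd.comp (measurable_snd.comp measurable_fst))
    exact (measurable_history_dataset hhyp hℓ hd η σ t).comp h2
  -- The empty batches that fill the future are harmless: the history up to time `t` uses only
  -- earlier ones.
  have hcongr : ∀ ω, history hyp ℓ η σ (dataset (St ω) (U ω)) (extendBatches t (X ω).2.2) t =
      history hyp ℓ η σ (dataset (St ω) (U ω)) (V ω) t := by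
    intro ω
    refine history_congr_batches _ _ _ _ _ fun k hk => ?_
    simp only [extendBatches, dif_pos hk, X, pastBatches]
    rfl
  have hpast : pastParams θ t = fun ω => H (X ω, Y ω) := by
    funext ω k
    have h1 : H (X ω, Y ω) = history hyp ℓ η σ (dataset (St ω) (U ω)) (V ω) t (Y ω) :=
      congrFun (hcongr ω) (Y ω)
    rw [h1, pastParams, h.eq_iterate]
    rfl
  have key := ae_of_ae_map hX.aemeasurable (condDistrib_ae_eq_map_of_indep hX hY hlaw hH)
  filter_upwards [key] with ω hω
  rw [trajectoryLaw, hpast]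
  refine hω.trans ?_
  rw [← hcongr ω]

end SGLD

end

/-! ### Assembly of the bound -/

theorem proposition7
    {Ω 𝒲 𝒵 : Type*} [MeasurableSpace Ω] [MeasurableSpace 𝒲] [MeasurableSpace 𝒵]
    {N d T : ℕ}
    (P : Measure Ω) [IsProbabilityMeasure P]
    (PZ : Measure 𝒵) [IsProbabilityMeasure PZ]
    (hyp : SGLD.Param d → 𝒲) (hhyp : Measurable hyp)
    (ℓ : 𝒲 → 𝒵 → ℝ) (hℓ : Measurable (Function.uncurry ℓ))
    (hℓ_diff : ∀ z, Differentiable ℝ fun θ : SGLD.Param d => ℓ (hyp θ) z)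
    (a b : ℝ) (hab : ∀ w z, ℓ w z ∈ Set.Icc a b)
    (η σ : Fin T → ℝ) (hσ : ∀ t, 0 < σ t)
    (St : Ω → SGLD.SuperSample N 𝒵) (U : Ω → Fin N → Bool) (J : Ω → Fin N)
    (V : Ω → Fin T → Finset (Fin N)) (ε : Ω → Fin T → SGLD.Param d)
    (θ : Fin (T + 1) → Ω → SGLD.Param d)
    (hSGLD : SGLD.IsSGLD P PZ hyp ℓ η σ St U J V ε θ)
    (π : (j : Fin N) → (t : Fin T) → SGLD.EstimateInput N d T 𝒵 j t → ℝ)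
    (hπ_meas : ∀ j t, Measurable (π j t))
    (hπ : ∀ j t x, π j t x ∈ Set.Icc (0 : ℝ) 1) :
    ENNReal.ofReal
        (∫ ω, SGLD.gen ℓ PZ (hyp (θ (Fin.last T) ω)) (SGLD.dataset (St ω) (U ω)) ∂P) ≤
      ENNReal.ofReal (√2 * (b - a)) *
        ∫⁻ ω, (∑ t : Fin T with J ω ∈ V ω t,
          ∫⁻ τ, ENNReal.ofReal
              (SGLD.mixtureTerm (SGLD.bit (U ω (J ω)))
                (π (J ω) t (fun i => U ω i, St ω, V ω, τ))
                (η t) (σ t) (V ω t).card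
                (SGLD.incoherence hyp ℓ (St ω) (J ω) (τ (Fin.last t))))
            ∂(SGLD.trajectoryLaw P St U V θ t (U ω, St ω, SGLD.pastBatches (V ω) t)))
          ^ (1 / 2 : ℝ) ∂P := by
  obtain ⟨ω₀⟩ := nonempty_of_isProbabilityMeasure P
  -- The existence of a random index in `Fin N` forces `N` to be positive.
  have hN : N ≠ 0 := (Fin.pos (J ω₀)).ne'
  have := Measure.isProbabilityMeasure_map (μ := P) hSGLD.measurable_V.aemeasurable
  have := Measure.isProbabilityMeasure_map (μ := P) hSGLD.measurable_init.aemeasurable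
  set ν := (P.map (θ 0)).prod (Measure.pi fun _ : Fin T => stdGaussian (SGLD.Param d)) with hν
  set μB := (Measure.pi fun _ : Fin N => uniformOn (Set.univ : Set Bool)).prod (P.map V)
  set Λ := (Measure.pi fun _ : Fin N => Measure.pi fun _ : Bool => PZ).prod μB
  let K : Fin N × (SGLD.SuperSample N 𝒵 × (Fin N → Bool) × (Fin T → Finset (Fin N))) → ℝ≥0∞ :=
    fun p => SGLD.pathCost hyp ℓ η σ π ν p.1 p.2.1 p.2.2.1 p.2.2.2 ^ (1 / 2 : ℝ)
  have hKm : Measurable K := measurable_from_prod_countable_right fun j =>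
    (SGLD.measurable_pathCost hhyp hℓ hℓ_diff η σ hπ_meas ν j).pow_const _
  have henv : Measurable fun ω => (St ω, U ω, V ω) :=
    hSGLD.measurable_St.prodMk (hSGLD.measurable_U.prodMk hSGLD.measurable_V)
  have hrhs : ∫⁻ ω, (∑ t : Fin T with J ω ∈ V ω t,
          ∫⁻ τ, ENNReal.ofReal
              (SGLD.mixtureTerm (SGLD.bit (U ω (J ω)))
                (π (J ω) t (fun i => U ω i, St ω, V ω, τ))
                (η t) (σ t) (V ω t).card
                (SGLD.incoherence hyp ℓ (St ω) (J ω) (τ (Fin.last t))))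
            ∂(SGLD.trajectoryLaw P St U V θ t (U ω, St ω, SGLD.pastBatches (V ω) t)))
          ^ (1 / 2 : ℝ) ∂P = (N : ℝ≥0∞)⁻¹ * ∑ j, ∫⁻ p, K (j, p) ∂Λ := by
    have h1 : ∀ᵐ ω ∂P, ∀ t, SGLD.trajectoryLaw P St U V θ t
        (U ω, St ω, SGLD.pastBatches (V ω) t) =
        ν.map (SGLD.history hyp ℓ η σ (SGLD.dataset (St ω) (U ω)) (V ω) t) :=
      ae_all_iff.2 fun t => hSGLD.trajectoryLaw_ae_eq hhyp hℓ hℓ_diff t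
    -- Once the conditional laws are replaced by path laws, the integrand depends on `ω` only
    -- through index, super-sample, bits and batches; the uniform index then becomes an average.
    have h2 := lintegral_map (μ := P) hKm (hSGLD.measurable_J.prodMk henv)
    rw [hSGLD.law_index, lintegral_prod _ hKm.aemeasurable, SGLD.lintegral_uniformOn_univ] at h2
    rw [h2]
    refine lintegral_congr_ae ?_
    filter_upwards [h1] with ω hω
    simp only [hω]
    rfl
  have hlhs : ∫ ω, SGLD.gen ℓ PZ (hyp (θ (Fin.last T) ω)) (SGLD.dataset (St ω) (U ω)) ∂P =
      (N : ℝ)⁻¹ * ∑ j, ∫ p, SGLD.ghostGap hyp ℓ η σ j p.1.1 p.1.2.1 p.1.2.2 p.2 ∂(Λ.prod ν) := by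
    have hgm : Measurable fun p : (SGLD.SuperSample N 𝒵 × (Fin N → Bool) ×
        (Fin T → Finset (Fin N))) × (SGLD.Param d × (Fin T → SGLD.Param d)) =>
        SGLD.gen ℓ PZ (hyp (SGLD.iterate hyp ℓ η σ (SGLD.dataset p.1.1 p.1.2.1) p.1.2.2 p.2 T))
          (SGLD.dataset p.1.1 p.1.2.1) := by
      have h1 : Measurable fun w => SGLD.popRisk ℓ PZ w :=
        (hℓ.stronglyMeasurable.integral_prod_right' (ν := PZ)).measurable
      refine (h1.comp (SGLD.measurable_final hhyp hℓ hℓ_diff η σ)).sub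
        (Measurable.div_const (Finset.measurable_fun_sum _ fun j _ => ?_) _)
      exact SGLD.measurable_loss_final hhyp hℓ hℓ_diff η σ j id
    have h2 := SGLD.integral_gen_eq hN hhyp hℓ hℓ_diff hab η σ PZ μB ν
    rw [← h2, ← hSGLD.law_env, integral_map
      (henv.prodMk (hSGLD.measurable_init.prodMk hSGLD.measurable_ε)).aemeasurable
      hgm.aestronglyMeasurable]
    refine integral_congr_ae (ae_of_all _ fun ω => ?_)
    simp only [hSGLD.eq_iterate (Fin.last T) ω, Fin.val_last]
  rw [hrhs, hlhs, ENNReal.ofReal_mul (by positivity), ENNReal.ofReal_inv_of_pos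
    (by exact_mod_cast Nat.pos_of_ne_zero hN), ENNReal.ofReal_natCast, mul_left_comm, Finset.mul_sum]
  gcongr
  -- Individual expected gaps may be negative, so the truncation `ENNReal.ofReal` is only
  -- subadditive over the index.
  refine (Finset.le_sum_of_subadditive ENNReal.ofReal ENNReal.ofReal_zero.le
    (fun _ _ => ENNReal.ofReal_add_le) _ _).trans (Finset.sum_le_sum fun j _ => ?_)
  exact SGLD.ofReal_integral_ghostGap_le hhyp hℓ hℓ_diff hab η hσ hπ_meas hπ (P.map (θ 0)) j _ _
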